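/- A metric graph is a (possibly infinite) graph, possibly with loops and multiple edges, in which each edge $e$ is isometrically an interval of length $\ell(e)>0$, and in which only finitely many different edge lengths occur; the distance between two points is the infimum of the lengths of piecewise linear paths joining them ($\infty$ if there is none). A closed edge-path in $\Gamma$ is a map $\gamma\colon C\to\Gamma$ from a circle $C$ subdivided into $n\ge 1$ edges that sends vertices to vertices and maps each open edge of $C$ homeomorphically onto an open edge of $\Gamma$; its length is the sum of the lengths of the $n$ edges of $\Gamma$ it traverses, counted with multiplicity. It is immersed if it is locally injective (equivalently, it never backtracks, also not at the base point), and it is a cycle of $\Gamma$ if it is injective. The girth of $\Gamma$ is the infimum of the lengths of its cycles ($\infty$ if there are none). **Corollary 1.7.** Let $\Gamma$ be a metric graph, and let $\gamma\colon C\to\Gamma$ be a closed edge-path immersed in $\Gamma$. Assume that - the girth of $\Gamma$ is at least $2\pi$, and - any two points $x,y\in\gamma(C)$ (vertices or interior points of edges) are at distance at most $\pi$ in $\Gamma$. Then the length of $\gamma$ is commensurable with $\pi$, that is, it is a rational multiple of $\pi$. -/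

import Mathlib

/-- A metric graph with vertex set `V` and edge set `E`, possibly infinite, possibly with loops and
multiple edges, not necessarily connected. Every edge `e` is a copy of the interval `[0, len e]`
whose endpoint `0` is attached to `src e` and whose endpoint `len e` is attached to `tgt e` (the
orientation only serves to name the two ends). Only finitely many edge lengths occur. -/
structure MetricGraph (V E : Type*) where
  src : E → V
  tgt : E → V
  len : E → ℝ
  len_pos : ∀ e, 0 < len e
  finite_range_len : (Set.range len).Finite

/-- Two real numbers (the second one nonzero) are commensurable if their ratio is rational. -/
def IsCommensurable (a b : ℝ) : Prop :=
  ∃ q : ℚ, a / b = (q : ℝ)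

namespace MetricGraph

/-- The points of the metric graph (of its geometric realization): its vertices, and for each edge
`e` the points in the interior of `e`, given by their position `t` in `(0, len e)`. -/
inductive Point {V E : Type*} (G : MetricGraph V E) where
  | vertex (v : V) : Point G
  | interior (e : E) (t : ℝ) (h0 : 0 < t) (h1 : t < G.len e) : Point G

/-- The characteristic map of the edge `e`, that is, the map from `[0, len e]` to the graph. It
sends `0` to the vertex `src e` and `len e` to the vertex `tgt e`. (It is only used for
`t ∈ [0, len e]`.) -/
noncomputable def pt {V E : Type*} (G : MetricGraph V E) (e : E) (t : ℝ) : G.Point :=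
  if h0 : 0 < t then
    if h1 : t < G.len e then Point.interior e t h0 h1 else Point.vertex (G.tgt e)
  else Point.vertex (G.src e)

/-- `G.HasPath x y L`: there is a piecewise linear path of length `L` from `x` to `y`, that is, a
finite concatenation of linear paths each of which runs inside one closed edge; the linear path
from position `s` to position `t` of an edge has length `|s - t|`. -/
inductive HasPath {V E : Type*} (G : MetricGraph V E) : G.Point → G.Point → ℝ → Prop where
  | refl (x : G.Point) : HasPath G x x 0
  | cons (e : E) (s t : ℝ) (y : G.Point) (L : ℝ)
      (hs : s ∈ Set.Icc 0 (G.len e)) (ht : t ∈ Set.Icc 0 (G.len e))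
      (h : HasPath G (G.pt e t) y L) : HasPath G (G.pt e s) y (|s - t| + L)

/-- The distance of two points of the metric graph: the infimum of the lengths of the piecewise
linear paths joining them (it is `∞` if they lie in different components). -/
noncomputable def dist {V E : Type*} (G : MetricGraph V E) (x y : G.Point) : ENNReal :=
  ⨅ (L : ℝ) (_ : G.HasPath x y L), ENNReal.ofReal L

/-- The initial vertex of the directed edge `d`: the directed edge `(e, true)` is `e` traversed from
`src e` to `tgt e`, and `(e, false)` is `e` traversed from `tgt e` to `src e`. -/
def dsrc {V E : Type*} (G : MetricGraph V E) (d : E × Bool) : V :=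
  if d.2 then G.src d.1 else G.tgt d.1

/-- The terminal vertex of a directed edge. -/
def dtgt {V E : Type*} (G : MetricGraph V E) (d : E × Bool) : V :=
  if d.2 then G.tgt d.1 else G.src d.1

/-- A closed edge-path `C → G`, where `C` is a circle subdivided into `n ≥ 1` edges: a cyclic
sequence of directed edges `d 0, …, d (n - 1)` of `G`, each starting where the previous one ends.
The addition in `Fin n` is modulo `n`, so that `d 0` follows `d (n - 1)`. -/
structure ClosedEdgePath {V E : Type*} (G : MetricGraph V E) where
  n : ℕ
  [n_ne_zero : NeZero n]
  d : Fin n → E × Bool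
  closed : ∀ i, G.dtgt (d i) = G.dsrc (d (i + 1))

attribute [instance] ClosedEdgePath.n_ne_zero

namespace ClosedEdgePath

/-- The length of a closed edge-path: the sum of the lengths of its edges, with multiplicity. -/
noncomputable def length {V E : Type*} {G : MetricGraph V E} (c : G.ClosedEdgePath) : ℝ :=
  ∑ i, G.len (c.d i).1

/-- The image of a closed edge-path: the union of the closed edges it traverses. -/
def image {V E : Type*} {G : MetricGraph V E} (c : G.ClosedEdgePath) : Set G.Point :=
  ⋃ i, G.pt (c.d i).1 '' Set.Icc 0 (G.len (c.d i).1)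

/-- A closed edge-path `C → G` is immersed if it is locally injective. This holds automatically in
the interiors of the edges of `C`; at the vertex of `C` between the edges `i` and `i + 1` it means
that the path does not backtrack: `d (i + 1)` is not `d i` traversed in the opposite direction. -/
def IsImmersed {V E : Type*} {G : MetricGraph V E} (c : G.ClosedEdgePath) : Prop :=
  ∀ i, c.d (i + 1) ≠ ((c.d i).1, !(c.d i).2)

/-- A closed edge-path `C → G` is embedded (that is, a cycle of `G`) if it is injective: distinct
vertices of `C` go to distinct vertices of `G`, and distinct edges of `C` to distinct edges of
`G`. -/
def IsCycle {V E : Type*} {G : MetricGraph V E} (c : G.ClosedEdgePath) : Prop :=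
  Function.Injective (fun i => G.dsrc (c.d i)) ∧ Function.Injective (fun i => (c.d i).1)

end ClosedEdgePath

/-- The girth: the infimum of the lengths of the cycles (`∞` for a forest). -/
noncomputable def girth {V E : Type*} (G : MetricGraph V E) : ENNReal :=
  ⨅ (c : G.ClosedEdgePath) (_ : c.IsCycle), ENNReal.ofReal c.length

end MetricGraph

/-! The proof is a version of Dehn's argument about rectangles tiled by squares, applied to products
of closed walks. The girth bound forces two distinct reduced walks with common endpoints to have
total length at least `2π` (`two_pi_le_add`), so geodesics shorter than `π` are unique. Together
with the diameter bound this makes distances rigid: along an edge of the image, the distance to a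
vertex of the image is either monotone or has a peak of height exactly `π` (`DiamLEPi.peak`). Hence
the edge length is a signed sum of the codistances `x = π - d` at the two ends (`DiamLEPi.len_eq`).

For additive `φ`, `ψ` and two different edges of lengths `a`, `b`, the mixed terms in `φ a * ψ b + ψ
a * φ b` cancel, leaving terms `± φ x * ψ x` at the four corners (`DiamLEPi.rectangle`). An edge
paired with itself also contributes strips of width `π` (`DiamLEPi.square`). Summed over the torus
of two closed immersed walks, the corner terms get nonnegative coefficients, because at most one
image edge at a vertex starts a given geodesic shorter than `π`. This gives `DiamLEPi.torus`: the
product of the two lengths is a nonnegative combination of squares plus strips measured by the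
overlap of the walks.

If the walk is a cycle, its overlap with itself is its length `L`. Were `L / π` irrational, some `φ`
would take the value `1` at both `π` and `L`, and the identity would read `2 = (nonnegative) + 4`.
In general, induct on the number of edges. A repeated directed edge cuts the walk into two shorter
closed immersed ones. A repeated vertex alone cuts it into two conjugates of shorter ones, and
`DiamLEPi.len_mul` rules out a `φ` vanishing at `π` but not at `L`. -/

namespace MetricGraph

/-! ### Edge-paths as lists of directed edges -/

variable {V E : Type*}

/-- A directed edge traversed in the opposite direction. -/
def opp (d : E × Bool) : E × Bool := (d.1, !d.2)

@[simp] lemma opp_opp (d : E × Bool) : opp (opp d) = d := by simp [opp]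

@[simp] lemma opp_fst (d : E × Bool) : (opp d).1 = d.1 := rfl

lemma opp_ne (d : E × Bool) : opp d ≠ d := by
  intro h
  have := congrArg Prod.snd h
  simp [opp] at this

lemma eq_or_eq_opp {d d' : E × Bool} (h : d.1 = d'.1) : d = d' ∨ d = opp d' := by
  obtain ⟨e, b⟩ := d
  obtain ⟨e', b'⟩ := d'
  simp only at h
  subst h
  cases b <;> cases b' <;> simp [opp]

variable (G : MetricGraph V E)

@[simp] lemma dsrc_opp (d : E × Bool) : G.dsrc (opp d) = G.dtgt d := by
  obtain ⟨e, b⟩ := d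
  cases b <;> simp [opp, dsrc, dtgt]

@[simp] lemma dtgt_opp (d : E × Bool) : G.dtgt (opp d) = G.dsrc d := by
  obtain ⟨e, b⟩ := d
  cases b <;> simp [opp, dsrc, dtgt]

/-- `G.IsWalk v l w`: the directed edges in `l` form an edge-path from `v` to `w`. -/
def IsWalk : V → List (E × Bool) → V → Prop
  | v, [], w => v = w
  | v, d :: l, w => G.dsrc d = v ∧ IsWalk (G.dtgt d) l w

/-- The length of a list of directed edges. -/
noncomputable def wlen (l : List (E × Bool)) : ℝ := (l.map fun d => G.len d.1).sum

/-- No directed edge in the list is followed by its opposite. -/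
def Reduced (l : List (E × Bool)) : Prop := l.IsChain fun d d' => d' ≠ opp d

/-- The list of directed edges traversed backwards. -/
def revWalk (l : List (E × Bool)) : List (E × Bool) := (l.map opp).reverse

@[simp] lemma isWalk_nil {v w : V} : G.IsWalk v [] w ↔ v = w := Iff.rfl

@[simp] lemma isWalk_cons {v w : V} {d : E × Bool} {l : List (E × Bool)} :
    G.IsWalk v (d :: l) w ↔ G.dsrc d = v ∧ G.IsWalk (G.dtgt d) l w := Iff.rfl

lemma isWalk_append {v w : V} {l l' : List (E × Bool)} :
    G.IsWalk v (l ++ l') w ↔ ∃ u, G.IsWalk v l u ∧ G.IsWalk u l' w := by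
  induction l generalizing v with
  | nil => simp
  | cons d l ih => simp [ih, and_assoc]

@[simp] lemma wlen_nil : G.wlen [] = 0 := by simp [wlen]

@[simp] lemma wlen_cons (d : E × Bool) (l : List (E × Bool)) :
    G.wlen (d :: l) = G.len d.1 + G.wlen l := by simp [wlen]

@[simp] lemma wlen_append (l l' : List (E × Bool)) :
    G.wlen (l ++ l') = G.wlen l + G.wlen l' := by simp [wlen]

lemma wlen_nonneg (l : List (E × Bool)) : 0 ≤ G.wlen l := by
  induction l with
  | nil => simp
  | cons d l ih => rw [wlen_cons]; linarith [G.len_pos d.1]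

lemma wlen_pos {l : List (E × Bool)} (h : l ≠ []) : 0 < G.wlen l := by
  cases l with
  | nil => exact absurd rfl h
  | cons d l => rw [wlen_cons]; linarith [G.len_pos d.1, G.wlen_nonneg l]

@[simp] lemma revWalk_nil : revWalk ([] : List (E × Bool)) = [] := rfl

@[simp] lemma revWalk_cons (d : E × Bool) (l : List (E × Bool)) :
    revWalk (d :: l) = revWalk l ++ [opp d] := by simp [revWalk]

@[simp] lemma wlen_revWalk (l : List (E × Bool)) : G.wlen (revWalk l) = G.wlen l := by
  induction l with
  | nil => simp
  | cons d l ih => simp [ih, add_comm]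

lemma mem_revWalk {d : E × Bool} {l : List (E × Bool)} : d ∈ revWalk l ↔ opp d ∈ l := by
  simp only [revWalk, List.mem_reverse, List.mem_map]
  constructor
  · rintro ⟨a, ha, rfl⟩; simpa using ha
  · intro h; exact ⟨_, h, opp_opp d⟩

lemma IsWalk.revWalk {v w : V} {l : List (E × Bool)} (h : G.IsWalk v l w) :
    G.IsWalk w (revWalk l) v := by
  induction l generalizing v with
  | nil => exact h.symm
  | cons d l ih =>
    rw [revWalk_cons, isWalk_append]
    exact ⟨_, ih h.2, by simpa using h.1⟩

lemma reduced_append {l l' : List (E × Bool)} :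
    Reduced (l ++ l') ↔ Reduced l ∧ Reduced l' ∧
      ∀ x ∈ l.getLast?, ∀ y ∈ l'.head?, y ≠ opp x := List.isChain_append

lemma reduced_cons {d : E × Bool} {l : List (E × Bool)} :
    Reduced (d :: l) ↔ (∀ y ∈ l.head?, y ≠ opp d) ∧ Reduced l := List.isChain_cons

lemma Reduced.revWalk {l : List (E × Bool)} (h : Reduced l) : Reduced (revWalk l) := by
  unfold MetricGraph.revWalk Reduced
  rw [List.isChain_reverse, List.isChain_map]
  refine List.IsChain.imp ?_ h
  intro a b hab hba
  exact hab (by rw [hba, opp_opp])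

/-- A list in which `f` takes a value twice. -/
lemma exists_split_of_not_nodup {α β : Type*} (f : α → β) {l : List α}
    (h : ¬ (l.map f).Nodup) :
    ∃ l₁ a l₂ b l₃, l = l₁ ++ a :: (l₂ ++ b :: l₃) ∧ f a = f b := by
  induction l with
  | nil => simp at h
  | cons a t ih =>
    by_cases ha : f a ∈ t.map f
    · obtain ⟨b, hb, hab⟩ := List.mem_map.1 ha
      obtain ⟨s, t', rfl⟩ := List.append_of_mem hb
      exact ⟨[], a, s, b, t', rfl, hab.symm⟩
    · have : ¬ (t.map f).Nodup := fun h' => h (by simpa using ⟨by simpa using ha, h'⟩)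
      obtain ⟨l₁, a', l₂, b, l₃, rfl, hab⟩ := ih this
      exact ⟨a :: l₁, a', l₂, b, l₃, rfl, hab⟩

lemma IsWalk.dtgt_getElem {v w : V} {l : List (E × Bool)} (h : G.IsWalk v l w) (i : ℕ)
    (hi : i + 1 < l.length) : G.dtgt l[i] = G.dsrc l[i + 1] := by
  induction l generalizing v i with
  | nil => simp at hi
  | cons d l ih =>
    cases i with
    | zero =>
      cases l with
      | nil => simp at hi
      | cons d' l => exact h.2.1.symm
    | succ i => exact ih h.2 i (by simpa using hi)

lemma Reduced.getElem_ne {l : List (E × Bool)} (h : Reduced l) (i : ℕ)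
    (hi : i + 1 < l.length) : l[i + 1] ≠ opp l[i] :=
  List.isChain_iff_getElem.1 h i hi

/-- Doubling a list makes the cyclic successor an ordinary one, so cyclic conditions can be read off
from linear ones on `l ++ l`. -/
lemma getElem_append_self_succ {α : Type*} {l : List α} [NeZero l.length] (i : Fin l.length)
    (h : i.1 + 1 < (l ++ l).length) : (l ++ l)[i.1 + 1] = l[i + 1] := by
  have hv : (i + 1).1 = (i.1 + 1) % l.length := by
    rw [Fin.val_add, Fin.val_one', Nat.add_mod_mod]
  have hlt := i.2
  rcases Nat.lt_or_ge (i.1 + 1) l.length with h1 | h1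
  · rw [Nat.mod_eq_of_lt h1] at hv
    rw [List.getElem_append_left h1]
    simp only [Fin.getElem_fin, hv]
  · have he : i.1 + 1 = l.length := by omega
    rw [he, Nat.mod_self] at hv
    rw [List.getElem_append_right h1]
    simp only [Fin.getElem_fin, hv, he, Nat.sub_self]

lemma IsWalk.dtgt_cyclic {v : V} {l : List (E × Bool)} (h : G.IsWalk v l v) [NeZero l.length]
    (i : Fin l.length) : G.dtgt l[i] = G.dsrc l[i + 1] := by
  have h2 : G.IsWalk v (l ++ l) v := (G.isWalk_append).2 ⟨v, h, h⟩
  have hi : i.1 + 1 < (l ++ l).length := by have := i.2; simp; omega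
  have := h2.dtgt_getElem G i hi
  rwa [List.getElem_append_left i.2, getElem_append_self_succ i hi] at this

lemma Reduced.ne_cyclic {l : List (E × Bool)} (h2 : Reduced (l ++ l)) [NeZero l.length]
    (i : Fin l.length) : l[i + 1] ≠ opp l[i] := by
  have hi : i.1 + 1 < (l ++ l).length := by have := i.2; simp; omega
  have := h2.getElem_ne i hi
  rwa [List.getElem_append_left i.2, getElem_append_self_succ i hi] at this

end MetricGraph

/-! ### Consequences of the girth bound -/

namespace MetricGraph

variable {V E : Type*} (G : MetricGraph V E)

lemma two_pi_le_length_of_isCycle (hg : ENNReal.ofReal (2 * Real.pi) ≤ G.girth)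
    (c : G.ClosedEdgePath) (hc : c.IsCycle) : 2 * Real.pi ≤ c.length := by
  have h1 : ENNReal.ofReal (2 * Real.pi) ≤ ENNReal.ofReal c.length :=
    hg.trans (iInf₂_le c hc)
  have h0 : 0 ≤ c.length := Finset.sum_nonneg fun i _ => (G.len_pos _).le
  exact (ENNReal.ofReal_le_ofReal_iff h0).1 h1

lemma sum_getElem_len (l : List (E × Bool)) :
    ∑ i : Fin l.length, G.len l[i].1 = G.wlen l :=
  Fin.sum_univ_fun_getElem l fun d => G.len d.1

lemma two_pi_le_wlen_of_nodup (hg : ENNReal.ofReal (2 * Real.pi) ≤ G.girth) {v : V}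
    {l : List (E × Bool)} (hne : l ≠ []) (hw : G.IsWalk v l v) (hr : Reduced l)
    (hnd : (l.map G.dsrc).Nodup) : 2 * Real.pi ≤ G.wlen l := by
  have : NeZero l.length := ⟨by simpa using hne⟩
  let c : G.ClosedEdgePath := ⟨l.length, fun i => l[i], fun i => hw.dtgt_cyclic G i⟩
  have hinj : ∀ i j : Fin l.length, G.dsrc l[i] = G.dsrc l[j] → i = j := by
    intro i j hij
    have hi : i.1 < (l.map G.dsrc).length := by simp
    have hj : j.1 < (l.map G.dsrc).length := by simp
    have := (hnd.getElem_inj_iff (hi := hi) (hj := hj)).1 (by simpa using hij)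
    exact Fin.ext this
  have hadj : ∀ i j : Fin l.length, i.1 + 1 = j.1 → l[j] ≠ opp l[i] := by
    intro i j hij
    have h2 : i.1 + 1 < l.length := by rw [hij]; exact j.2
    have := hr.getElem_ne i.1 h2
    simpa [hij] using this
  have hc : c.IsCycle := by
    refine ⟨fun i j hij => hinj i j hij, fun i j hij => ?_⟩
    rcases eq_or_eq_opp (d := l[i]) (d' := l[j]) hij with h | h
    · exact hinj i j (by rw [h])
    · have h1 : i = j + 1 := hinj _ _ (by rw [h, dsrc_opp, hw.dtgt_cyclic G j])
      have h' : l[j] = opp l[i] := by rw [h, opp_opp]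
      have h2 : j = i + 1 := hinj _ _ (by rw [h', dsrc_opp, hw.dtgt_cyclic G i])
      -- An edge traversed both ways gives `i = j + 1` and `j = i + 1` cyclically. If `i ≠ j`, the
      -- successor of the smaller index does not wrap around, so the opposite edges are adjacent in
      -- the list; linear reducedness suffices.
      by_contra hne'
      have hv1 : i.1 = (j.1 + 1) % l.length := by
        conv_lhs => rw [h1]
        rw [Fin.val_add, Fin.val_one', Nat.add_mod_mod]
      have hv2 : j.1 = (i.1 + 1) % l.length := by
        conv_lhs => rw [h2]
        rw [Fin.val_add, Fin.val_one', Nat.add_mod_mod]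
      rcases lt_or_gt_of_ne (fun hh => hne' (Fin.ext hh) : i.1 ≠ j.1) with hlt | hlt
      · rw [Nat.mod_eq_of_lt (by have : j.1 < l.length := j.2; omega)] at hv2
        exact hadj i j hv2.symm h'
      · rw [Nat.mod_eq_of_lt (by have : i.1 < l.length := i.2; omega)] at hv1
        exact hadj j i hv1.symm h
  have := G.two_pi_le_length_of_isCycle hg c hc
  rwa [ClosedEdgePath.length, show ∑ i, G.len (c.d i).1 = G.wlen l
    from G.sum_getElem_len l] at this

/-- A nonempty reduced closed walk contains a cycle, so it has length at least `2π`. -/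
lemma two_pi_le_wlen (hg : ENNReal.ofReal (2 * Real.pi) ≤ G.girth) {v : V}
    {l : List (E × Bool)} (hne : l ≠ []) (hw : G.IsWalk v l v) (hr : Reduced l) :
    2 * Real.pi ≤ G.wlen l := by
  induction hn : l.length using Nat.strong_induction_on generalizing v l with
  | _ n ih =>
    by_cases hnd : (l.map G.dsrc).Nodup
    · exact G.two_pi_le_wlen_of_nodup hg hne hw hr hnd
    · obtain ⟨l₁, a, l₂, b, l₃, rfl, hab⟩ := exists_split_of_not_nodup _ hnd
      obtain ⟨u, -, hw2⟩ := (G.isWalk_append).1 hw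
      rw [← List.cons_append] at hw2
      obtain ⟨u', hw3, hw4⟩ := (G.isWalk_append).1 hw2
      have hu : G.dsrc a = u := hw3.1
      have hu' : G.dsrc b = u' := hw4.1
      have hr2 : Reduced (a :: l₂) := by
        have := (reduced_append.1 hr).2.1
        rw [← List.cons_append] at this
        exact (reduced_append.1 this).1
      have := ih (a :: l₂).length (by rw [← hn]; simp; omega) (v := u) (by simp)
        (by rw [← hu', ← hab, hu] at hw3; exact hw3) hr2 rfl
      simp only [wlen_append, wlen_cons] at this ⊢
      linarith [G.wlen_nonneg l₁, G.wlen_nonneg l₃, G.len_pos b.1]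

/-- Two different reduced walks with the same endpoints have total length at least `2π`. -/
lemma two_pi_le_add (hg : ENNReal.ofReal (2 * Real.pi) ≤ G.girth) {v w : V}
    {p q : List (E × Bool)} (hp : G.IsWalk v p w) (hq : G.IsWalk v q w) (hrp : Reduced p)
    (hrq : Reduced q) (hne : p ≠ q) : 2 * Real.pi ≤ G.wlen p + G.wlen q := by
  induction p generalizing v q with
  | nil =>
    have : v = w := hp
    subst this
    have := G.two_pi_le_wlen hg (Ne.symm hne) hq hrq
    simpa using this
  | cons d p ih =>
    cases q with
    | nil =>
      have : v = w := hq
      subst this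
      have := G.two_pi_le_wlen hg hne hp hrp
      simpa using this
    | cons d' q =>
      by_cases hd : d = d'
      · subst hd
        have := ih hp.2 hq.2 (reduced_cons.1 hrp).2 (reduced_cons.1 hrq).2
          (fun h => hne (by rw [h]))
        simp only [wlen_cons]
        linarith [G.len_pos d.1]
      -- Once the common initial segment is removed, the first edges differ, so going back along one
      -- walk and out along the other does not backtrack at the junction.
      · have hred : Reduced (revWalk (d' :: q) ++ d :: p) := by
          refine reduced_append.2 ⟨hrq.revWalk, hrp, ?_⟩
          simp only [revWalk_cons, List.getLast?_concat, List.head?_cons, Option.mem_def,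
            Option.some.injEq]
          rintro x rfl y rfl h
          exact hd (by rw [h, opp_opp])
        have := G.two_pi_le_wlen hg (v := w) (by simp)
          ((G.isWalk_append).2 ⟨v, hq.revWalk, hp⟩) hred
        rw [wlen_append, wlen_revWalk] at this
        linarith

/-! ### Geodesics between vertices -/

/-- The distance of two vertices, as a real number (meaningful if some walk joins them). -/
noncomputable def vdist (v w : V) : ℝ := sInf {L | ∃ l, G.IsWalk v l w ∧ G.wlen l = L}

lemma vdist_le {v w : V} {l : List (E × Bool)} (h : G.IsWalk v l w) :
    G.vdist v w ≤ G.wlen l :=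
  csInf_le ⟨0, by rintro _ ⟨l, -, rfl⟩; exact G.wlen_nonneg l⟩ ⟨l, h, rfl⟩

lemma wlen_mem_closure (l : List (E × Bool)) :
    G.wlen l ∈ AddSubmonoid.closure (Set.range G.len) := by
  induction l with
  | nil => simp
  | cons d l ih =>
    rw [wlen_cons]
    exact add_mem (AddSubmonoid.subset_closure ⟨_, rfl⟩) ih

/-- Finiteness of the set of edge lengths enters here: walk lengths lie in the additive monoid
generated by finitely many positive reals, which is well ordered, so the infimum is attained even in
an infinite graph. -/
lemma exists_geodesic {v w : V} (h : ∃ l, G.IsWalk v l w) :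
    ∃ l, G.IsWalk v l w ∧ G.wlen l = G.vdist v w := by
  have hpwo : ((AddSubmonoid.closure (Set.range G.len) : AddSubmonoid ℝ) : Set ℝ).IsPWO :=
    Set.IsPWO.addSubmonoid_closure (by rintro _ ⟨e, rfl⟩; exact (G.len_pos e).le)
      G.finite_range_len.isPWO
  have hwf : {L | ∃ l, G.IsWalk v l w ∧ G.wlen l = L}.IsWF :=
    (hpwo.mono (by rintro _ ⟨l, -, rfl⟩; exact G.wlen_mem_closure l)).isWF
  obtain ⟨l, hl⟩ := h
  have hne : {L | ∃ l, G.IsWalk v l w ∧ G.wlen l = L}.Nonempty := ⟨_, l, hl, rfl⟩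
  have hleast : IsLeast {L | ∃ l, G.IsWalk v l w ∧ G.wlen l = L} (hwf.min hne) :=
    ⟨hwf.min_mem hne, fun x hx => hwf.min_le hne hx⟩
  have : G.vdist v w ∈ {L | ∃ l, G.IsWalk v l w ∧ G.wlen l = L} := by
    rw [vdist, hleast.csInf_eq]; exact hleast.1
  exact this

lemma vdist_nonneg (v w : V) : 0 ≤ G.vdist v w :=
  Real.sInf_nonneg (by rintro _ ⟨l, -, rfl⟩; exact G.wlen_nonneg l)

lemma vdist_comm (v w : V) : G.vdist v w = G.vdist w v := by
  unfold vdist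
  congr 1
  ext L
  constructor <;> rintro ⟨l, hl, rfl⟩ <;> exact ⟨_, hl.revWalk, G.wlen_revWalk l⟩

@[simp] lemma vdist_self (v : V) : G.vdist v v = 0 :=
  le_antisymm (by simpa using G.vdist_le (v := v) (w := v) (l := []) rfl) (G.vdist_nonneg v v)

/-- A walk of minimal length is reduced. -/
lemma reduced_of_geodesic {v w : V} {l : List (E × Bool)} (h : G.IsWalk v l w)
    (hl : G.wlen l = G.vdist v w) : Reduced l := by
  by_contra hred
  unfold Reduced at hred
  rw [List.isChain_iff_getElem] at hred
  push Not at hred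
  obtain ⟨i, hi, hd⟩ := hred
  have hsplit : l = l.take i ++ (l[i] :: l[i + 1] :: l.drop (i + 2)) := by
    rw [List.getElem_cons_drop, List.getElem_cons_drop, List.take_append_drop]
  rw [hsplit, isWalk_append] at h
  obtain ⟨u, h1, h2⟩ := h
  rw [isWalk_cons, isWalk_cons, hd, dtgt_opp] at h2
  obtain ⟨rfl, -, h2⟩ := h2
  have h3 := G.vdist_le ((G.isWalk_append).2 ⟨_, h1, h2⟩)
  rw [← hl] at h3
  conv_lhs at h3 => rw [hsplit]
  simp only [wlen_append, wlen_cons] at h3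
  linarith [G.len_pos l[i].1, G.len_pos l[i + 1].1]

lemma exists_walk_cons {d : E × Bool} {w : V} (h : ∃ l, G.IsWalk (G.dtgt d) l w) :
    ∃ l, G.IsWalk (G.dsrc d) l w := by
  obtain ⟨l, hl⟩ := h
  exact ⟨d :: l, rfl, hl⟩

lemma vdist_le_cons (d : E × Bool) {w : V} (h : ∃ l, G.IsWalk (G.dtgt d) l w) :
    G.vdist (G.dsrc d) w ≤ G.len d.1 + G.vdist (G.dtgt d) w := by
  obtain ⟨l, hl, hlen⟩ := G.exists_geodesic h
  rw [← hlen, ← wlen_cons]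
  exact G.vdist_le ⟨rfl, hl⟩

end MetricGraph

/-! ### Interior points of edges and the diameter bound -/

namespace MetricGraph

variable {V E : Type*} (G : MetricGraph V E)

/-- `G.IsEnd x v δ`: the vertex `v` is at distance `δ` of `x` along the closed edge containing `x`
(and `v = x` if `x` is a vertex). -/
def IsEnd : G.Point → V → ℝ → Prop
  | .vertex u, v, δ => v = u ∧ δ = 0
  | .interior e t _ _, v, δ => (v = G.src e ∧ δ = t) ∨ (v = G.tgt e ∧ δ = G.len e - t)

lemma pt_zero (e : E) : G.pt e 0 = .vertex (G.src e) := by simp [pt]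

lemma pt_len (e : E) : G.pt e (G.len e) = .vertex (G.tgt e) := by simp [pt, G.len_pos e]

lemma pt_interior (e : E) {t : ℝ} (h0 : 0 < t) (h1 : t < G.len e) :
    G.pt e t = .interior e t h0 h1 := by simp [pt, h0, h1]

lemma pt_cases (e : E) {t : ℝ} (ht : t ∈ Set.Icc 0 (G.len e)) :
    t = 0 ∨ t = G.len e ∨ 0 < t ∧ t < G.len e := by
  rcases ht.1.eq_or_lt with h | h
  · exact .inl h.symm
  · rcases ht.2.eq_or_lt with h' | h'
    · exact .inr (.inl h')
    · exact .inr (.inr ⟨h, h'⟩)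

lemma isEnd_pt_src (e : E) {s : ℝ} (hs : s ∈ Set.Icc 0 (G.len e)) :
    ∃ v δ l, G.IsEnd (G.pt e s) v δ ∧ G.IsWalk v l (G.src e) ∧ δ + G.wlen l = s := by
  rcases G.pt_cases e hs with rfl | rfl | ⟨h0, h1⟩
  · exact ⟨G.src e, 0, [], by rw [pt_zero]; exact ⟨rfl, rfl⟩, rfl, by simp⟩
  · exact ⟨G.tgt e, 0, [(e, false)], by rw [pt_len]; exact ⟨rfl, rfl⟩, by simp [dsrc, dtgt],
      by simp⟩
  · exact ⟨G.src e, s, [], by rw [G.pt_interior e h0 h1]; exact .inl ⟨rfl, rfl⟩, rfl, by simp⟩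

lemma isEnd_pt_tgt (e : E) {s : ℝ} (hs : s ∈ Set.Icc 0 (G.len e)) :
    ∃ v δ l, G.IsEnd (G.pt e s) v δ ∧ G.IsWalk v l (G.tgt e) ∧ δ + G.wlen l = G.len e - s := by
  rcases G.pt_cases e hs with rfl | rfl | ⟨h0, h1⟩
  · exact ⟨G.src e, 0, [(e, true)], by rw [pt_zero]; exact ⟨rfl, rfl⟩, by simp [dsrc, dtgt],
      by simp⟩
  · exact ⟨G.tgt e, 0, [], by rw [pt_len]; exact ⟨rfl, rfl⟩, rfl, by simp⟩
  · exact ⟨G.tgt e, G.len e - s, [], by rw [G.pt_interior e h0 h1]; exact .inr ⟨rfl, rfl⟩, rfl,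
      by simp⟩

lemma isEnd_pt {e : E} {t : ℝ} (ht : t ∈ Set.Icc 0 (G.len e)) {v : V} {δ : ℝ}
    (h : G.IsEnd (G.pt e t) v δ) :
    (v = G.src e ∧ δ = t) ∨ (v = G.tgt e ∧ δ = G.len e - t) := by
  rcases G.pt_cases e ht with rfl | rfl | ⟨h0, h1⟩
  · rw [pt_zero] at h; exact .inl h
  · rw [pt_len] at h; exact .inr ⟨h.1, by rw [h.2]; ring⟩
  · rw [G.pt_interior e h0 h1] at h; exact h

lemma exists_isEnd_step {e : E} {s t : ℝ} (hs : s ∈ Set.Icc 0 (G.len e))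
    (ht : t ∈ Set.Icc 0 (G.len e)) {v : V} {δ : ℝ} (h : G.IsEnd (G.pt e t) v δ) :
    ∃ v' δ' l, G.IsEnd (G.pt e s) v' δ' ∧ G.IsWalk v' l v ∧ δ' + G.wlen l ≤ |s - t| + δ := by
  rcases G.isEnd_pt ht h with ⟨rfl, rfl⟩ | ⟨rfl, rfl⟩
  · obtain ⟨v', δ', l, h1, h2, h3⟩ := G.isEnd_pt_src e hs
    exact ⟨v', δ', l, h1, h2, by linarith [le_abs_self (s - δ)]⟩
  · obtain ⟨v', δ', l, h1, h2, h3⟩ := G.isEnd_pt_tgt e hs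
    exact ⟨v', δ', l, h1, h2, by linarith [neg_abs_le (s - t)]⟩

/-- A piecewise linear path either runs (up to shortening) inside the interior of one edge, or it
can be replaced by an edge-path together with two initial and final pieces of edges. -/
lemma HasPath.exists_walk {x y : G.Point} {L : ℝ} (h : G.HasPath x y L) :
    (∃ v δ w δ' l, G.IsEnd x v δ ∧ G.IsEnd y w δ' ∧ G.IsWalk v l w ∧ δ + G.wlen l + δ' ≤ L) ∨
    ∃ e s t, (0 < s ∧ s < G.len e) ∧ (0 < t ∧ t < G.len e) ∧ x = G.pt e s ∧ y = G.pt e t ∧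
      |s - t| ≤ L := by
  induction h with
  | refl x =>
    cases x with
    | vertex u => exact .inl ⟨u, 0, u, 0, [], ⟨rfl, rfl⟩, ⟨rfl, rfl⟩, rfl, by simp⟩
    | interior e t h0 h1 =>
      exact .inr ⟨e, t, t, ⟨h0, h1⟩, ⟨h0, h1⟩, (G.pt_interior e h0 h1).symm,
        (G.pt_interior e h0 h1).symm, by simp⟩
  | cons e s t y L hs ht _ ih =>
    rcases ih with ⟨v, δ, w, δ', l, h1, h2, h3, h4⟩ | ⟨e', s', t', hs', ht', h1, h2, h3⟩
    · obtain ⟨v', δ'', l', k1, k2, k3⟩ := G.exists_isEnd_step hs ht h1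
      refine .inl ⟨v', δ'', w, δ', l' ++ l, k1, h2, (G.isWalk_append).2 ⟨_, k2, h3⟩, ?_⟩
      rw [wlen_append]; linarith
    -- An interior point determines its edge and its position, so the new piece lies in the same
    -- edge as the rest of the path.
    · obtain ⟨rfl, rfl⟩ : e = e' ∧ t = s' := by
        rw [G.pt_interior e' hs'.1 hs'.2] at h1
        rcases G.pt_cases e ht with rfl | rfl | ⟨h0, h0'⟩
        · rw [pt_zero] at h1; exact absurd h1 (by simp)
        · rw [pt_len] at h1; exact absurd h1 (by simp)
        · rw [G.pt_interior e h0 h0'] at h1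
          simpa using h1
      have htri : |s - t'| ≤ |s - t| + |t - t'| := abs_sub_le s t t'
      rcases G.pt_cases e hs with rfl | rfl | ⟨h0, h0'⟩
      · refine .inl ⟨G.src e, 0, G.src e, t', [], by rw [pt_zero]; exact ⟨rfl, rfl⟩,
          by rw [h2, G.pt_interior e ht'.1 ht'.2]; exact .inl ⟨rfl, rfl⟩, rfl, ?_⟩
        rw [wlen_nil]
        linarith [neg_abs_le (0 - t')]
      · refine .inl ⟨G.tgt e, 0, G.tgt e, G.len e - t', [], by rw [pt_len]; exact ⟨rfl, rfl⟩,
          by rw [h2, G.pt_interior e ht'.1 ht'.2]; exact .inr ⟨rfl, rfl⟩, rfl, ?_⟩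
        rw [wlen_nil]
        linarith [le_abs_self (G.len e - t')]
      · exact .inr ⟨e, s, t', ⟨h0, h0'⟩, ht', rfl, h2, by linarith⟩

lemma exists_hasPath_lt {x y : G.Point} {r r' : ℝ} (h : G.dist x y ≤ ENNReal.ofReal r)
    (h0 : 0 ≤ r) (hr : r < r') : ∃ L < r', G.HasPath x y L := by
  have : G.dist x y < ENNReal.ofReal r' :=
    h.trans_lt ((ENNReal.ofReal_lt_ofReal_iff (h0.trans_lt hr)).2 hr)
  unfold dist at this
  obtain ⟨L, hL⟩ := iInf_lt_iff.1 this
  obtain ⟨hp, hL⟩ := iInf_lt_iff.1 hL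
  exact ⟨L, (ENNReal.ofReal_lt_ofReal_iff (h0.trans_lt hr)).1 hL, hp⟩

/-- The point at distance `s` of the initial vertex on the directed edge `d`. -/
noncomputable def dpt (d : E × Bool) (s : ℝ) : G.Point :=
  if d.2 then G.pt d.1 s else G.pt d.1 (G.len d.1 - s)

lemma dpt_mem (d : E × Bool) {s : ℝ} (hs : s ∈ Set.Icc 0 (G.len d.1)) :
    G.dpt d s ∈ G.pt d.1 '' Set.Icc 0 (G.len d.1) := by
  unfold dpt
  split_ifs
  · exact ⟨s, hs, rfl⟩
  · exact ⟨_, ⟨by linarith [hs.2], by linarith [hs.1]⟩, rfl⟩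

lemma dpt_zero (d : E × Bool) : G.dpt d 0 = .vertex (G.dsrc d) := by
  obtain ⟨e, b⟩ := d
  cases b <;> simp [dpt, dsrc, pt_zero, pt_len]

lemma isEnd_dpt {d : E × Bool} {s : ℝ} (h0 : 0 < s) (h1 : s < G.len d.1) {v : V} {δ : ℝ}
    (h : G.IsEnd (G.dpt d s) v δ) :
    (v = G.dsrc d ∧ δ = s) ∨ (v = G.dtgt d ∧ δ = G.len d.1 - s) := by
  obtain ⟨e, b⟩ := d
  cases b
  · simp only [dpt, Bool.false_eq_true, if_false] at h
    rcases G.isEnd_pt ⟨by linarith, by linarith⟩ h with h | h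
    · exact .inr (by simpa [dtgt] using h)
    · exact .inl (by simpa [dsrc] using h)
  · simp only [dpt, if_true] at h
    rcases G.isEnd_pt ⟨h0.le, h1.le⟩ h with h | h
    · exact .inl (by simpa [dsrc] using h)
    · exact .inr (by simpa [dtgt] using h)

lemma dpt_eq_pt {d : E × Bool} {s : ℝ} (h0 : 0 < s) (h1 : s < G.len d.1) {e : E} {t : ℝ}
    (ht : 0 < t ∧ t < G.len e) (h : G.dpt d s = G.pt e t) : d.1 = e := by
  rw [G.pt_interior e ht.1 ht.2, dpt] at h
  split_ifs at h
  · rw [G.pt_interior d.1 h0 h1] at h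
    simp only [Point.interior.injEq] at h
    exact h.1
  · rw [G.pt_interior d.1 (by linarith) (by linarith)] at h
    simp only [Point.interior.injEq] at h
    exact h.1

/-- All points on the edges in `S` have distance at most `π`. -/
def DiamLEPi (S : Set E) : Prop :=
  ∀ d : E × Bool, d.1 ∈ S → ∀ s ∈ Set.Icc 0 (G.len d.1), ∀ d' : E × Bool, d'.1 ∈ S →
    ∀ t ∈ Set.Icc 0 (G.len d'.1), G.dist (G.dpt d s) (G.dpt d' t) ≤ ENNReal.ofReal Real.pi

variable {G} {S : Set E}

lemma zero_mem_Icc_len (d : E × Bool) : (0 : ℝ) ∈ Set.Icc 0 (G.len d.1) :=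
  ⟨le_rfl, (G.len_pos _).le⟩

lemma DiamLEPi.exists_walk_lt (hS : G.DiamLEPi S) {d d' : E × Bool} (hd : d.1 ∈ S)
    (hd' : d'.1 ∈ S) {r : ℝ} (hr : Real.pi < r) :
    ∃ l, G.IsWalk (G.dsrc d) l (G.dsrc d') ∧ G.wlen l < r := by
  have h := hS d hd 0 (zero_mem_Icc_len d) d' hd' 0 (zero_mem_Icc_len d')
  rw [dpt_zero, dpt_zero] at h
  obtain ⟨L, hL, hp⟩ := G.exists_hasPath_lt h Real.pi_pos.le hr
  rcases hp.exists_walk with ⟨v, δ, w, δ', l, h1, h2, h3, h4⟩ | ⟨e, s, t, hs, -, h1, -⟩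
  · obtain ⟨rfl, rfl⟩ := h1
    obtain ⟨rfl, rfl⟩ := h2
    exact ⟨l, h3, by linarith⟩
  · rw [G.pt_interior e hs.1 hs.2] at h1
    exact absurd h1 (by simp)

lemma DiamLEPi.exists_walk (hS : G.DiamLEPi S) {d d' : E × Bool} (hd : d.1 ∈ S)
    (hd' : d'.1 ∈ S) : ∃ l, G.IsWalk (G.dsrc d) l (G.dsrc d') := by
  obtain ⟨l, hl, -⟩ := hS.exists_walk_lt hd hd' (lt_add_one Real.pi)
  exact ⟨l, hl⟩

lemma DiamLEPi.vdist_le_pi (hS : G.DiamLEPi S) {d d' : E × Bool} (hd : d.1 ∈ S)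
    (hd' : d'.1 ∈ S) : G.vdist (G.dsrc d) (G.dsrc d') ≤ Real.pi := by
  refine le_of_forall_gt_imp_ge_of_dense fun r hr => ?_
  obtain ⟨l, hl, hlt⟩ := hS.exists_walk_lt hd hd' hr
  exact (G.vdist_le hl).trans hlt.le

lemma DiamLEPi.point_vertex (hS : G.DiamLEPi S) {d d' : E × Bool} (hd : d.1 ∈ S)
    (hd' : d'.1 ∈ S) {s : ℝ} (h0 : 0 < s) (h1 : s < G.len d.1) :
    s + G.vdist (G.dsrc d) (G.dsrc d') ≤ Real.pi ∨
      G.len d.1 - s + G.vdist (G.dtgt d) (G.dsrc d') ≤ Real.pi := by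
  by_contra! hcon
  have h := hS d hd s ⟨h0.le, h1.le⟩ d' hd' 0 (zero_mem_Icc_len d')
  obtain ⟨L, hL, hp⟩ := G.exists_hasPath_lt h Real.pi_pos.le (lt_min hcon.1 hcon.2)
  rw [lt_min_iff] at hL
  rw [dpt_zero] at hp
  rcases hp.exists_walk with ⟨v, δ, w, δ', l, k1, k2, k3, k4⟩ | ⟨e, s', t, -, ht, -, k2, -⟩
  · obtain ⟨rfl, rfl⟩ := k2
    have := G.vdist_le k3
    rcases G.isEnd_dpt h0 h1 k1 with ⟨rfl, rfl⟩ | ⟨rfl, rfl⟩ <;> linarith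
  · rw [G.pt_interior e ht.1 ht.2] at k2
    exact absurd k2 (by simp)

/-- A path between interior points of different edges leaves the first edge through one end and
enters the second through one end. If all four routes were longer than `π`, a path shorter than
their minimum would give a contradiction. -/
lemma DiamLEPi.point_point (hS : G.DiamLEPi S) {d d' : E × Bool} (hd : d.1 ∈ S)
    (hd' : d'.1 ∈ S) (hne : d.1 ≠ d'.1) {s t : ℝ} (h0 : 0 < s) (h1 : s < G.len d.1)
    (h0' : 0 < t) (h1' : t < G.len d'.1) :
    (s + G.vdist (G.dsrc d) (G.dsrc d') + t ≤ Real.pi ∨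
      s + G.vdist (G.dsrc d) (G.dtgt d') + (G.len d'.1 - t) ≤ Real.pi) ∨
    (G.len d.1 - s + G.vdist (G.dtgt d) (G.dsrc d') + t ≤ Real.pi ∨
      G.len d.1 - s + G.vdist (G.dtgt d) (G.dtgt d') + (G.len d'.1 - t) ≤ Real.pi) := by
  by_contra! hcon
  have h := hS d hd s ⟨h0.le, h1.le⟩ d' hd' t ⟨h0'.le, h1'.le⟩
  obtain ⟨L, hL, hp⟩ := G.exists_hasPath_lt h Real.pi_pos.le
    (lt_min (lt_min hcon.1.1 hcon.1.2) (lt_min hcon.2.1 hcon.2.2))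
  simp only [lt_min_iff] at hL
  rcases hp.exists_walk with ⟨v, δ, w, δ', l, k1, k2, k3, k4⟩ | ⟨e, s', t', hs', ht', k1, k2, -⟩
  · have := G.vdist_le k3
    rcases G.isEnd_dpt h0 h1 k1 with ⟨rfl, rfl⟩ | ⟨rfl, rfl⟩ <;>
      rcases G.isEnd_dpt h0' h1' k2 with ⟨rfl, rfl⟩ | ⟨rfl, rfl⟩ <;> linarith
  · exact hne ((G.dpt_eq_pt h0 h1 hs' k1).trans (G.dpt_eq_pt h0' h1' ht' k2).symm)

end MetricGraph

/-! ### Slopes of distance functions along edges -/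

namespace MetricGraph

variable {V E : Type*} (G : MetricGraph V E)

open scoped Classical in
/-- The sign of the derivative at `dsrc f` of the distance to `w` in the direction of `f`: it is
`-1` if a geodesic to `w` starts with `f`. -/
noncomputable def slope (f : E × Bool) (w : V) : ℝ :=
  if G.vdist (G.dsrc f) w = G.len f.1 + G.vdist (G.dtgt f) w then -1 else 1

/-- The distance to `w`, subtracted from `π`. -/
noncomputable def codist (v w : V) : ℝ := Real.pi - G.vdist v w

lemma codist_comm (v w : V) : G.codist v w = G.codist w v := by
  rw [codist, vdist_comm, codist]

@[simp] lemma codist_self (v : V) : G.codist v v = Real.pi := by simp [codist]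

lemma slope_cases (f : E × Bool) (w : V) : G.slope f w = 1 ∨ G.slope f w = -1 := by
  unfold slope
  split_ifs <;> simp

variable {G}

lemma slope_of_eq {f : E × Bool} {w : V}
    (h : G.vdist (G.dsrc f) w = G.len f.1 + G.vdist (G.dtgt f) w) : G.slope f w = -1 := if_pos h

lemma slope_of_ne {f : E × Bool} {w : V}
    (h : G.vdist (G.dsrc f) w ≠ G.len f.1 + G.vdist (G.dtgt f) w) : G.slope f w = 1 := if_neg h

lemma slope_eq_neg_one {f : E × Bool} {w : V} :
    G.slope f w = -1 ↔ G.vdist (G.dsrc f) w = G.len f.1 + G.vdist (G.dtgt f) w := by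
  refine ⟨fun h => ?_, slope_of_eq⟩
  by_contra hn
  rw [slope_of_ne hn] at h
  norm_num at h

lemma slope_self (f : E × Bool) : G.slope f (G.dsrc f) = 1 := by
  apply slope_of_ne
  rw [vdist_self]
  have := G.len_pos f.1
  have := G.vdist_nonneg (G.dtgt f) (G.dsrc f)
  linarith

lemma map_slope_mul (φ : ℝ →+ ℝ) (f : E × Bool) (w : V) (y : ℝ) :
    φ (G.slope f w * y) = G.slope f w * φ y := by
  rcases G.slope_cases f w with h | h <;> simp [h]

variable {S : Set E}

/-- A geodesic which does not start with `f`, prolonged by `f`, stays reduced. -/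
lemma exists_reduced_cons {f : E × Bool} {w : V} (h : ∃ l, G.IsWalk (G.dtgt f) l w)
    (hne : G.vdist (G.dtgt f) w ≠ G.len f.1 + G.vdist (G.dsrc f) w) :
    ∃ l, G.IsWalk (G.dsrc f) (f :: l) w ∧ Reduced (f :: l) ∧
      G.wlen (f :: l) = G.len f.1 + G.vdist (G.dtgt f) w := by
  obtain ⟨l, hl, hlen⟩ := G.exists_geodesic h
  refine ⟨l, ⟨rfl, hl⟩, reduced_cons.2 ⟨?_, G.reduced_of_geodesic hl hlen⟩, by simp [hlen]⟩
  rintro y hy rfl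
  cases l with
  | nil => simp at hy
  | cons d l =>
    simp only [List.head?_cons, Option.mem_def, Option.some.injEq] at hy
    subst hy
    have h1 := G.vdist_le hl.2
    rw [dtgt_opp] at h1
    rw [wlen_cons, opp_fst] at hlen
    have h2 : ∃ l, G.IsWalk (G.dtgt (opp f)) l w := ⟨l, hl.2⟩
    have h3 := G.vdist_le_cons (opp f) h2
    rw [dtgt_opp, dsrc_opp, opp_fst] at h3
    exact hne (by linarith)

/-- If a geodesic starts with `f`, the distance decreases along `f`. -/
lemma vdist_eq_of_geodesic_cons {f : E × Bool} {w v : V} {l : List (E × Bool)}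
    (h : G.IsWalk v (f :: l) w) (hl : G.wlen (f :: l) = G.vdist v w) :
    G.vdist (G.dsrc f) w = G.len f.1 + G.vdist (G.dtgt f) w := by
  obtain ⟨rfl, h⟩ := h
  have h1 := G.vdist_le h
  have h2 := G.vdist_le_cons f ⟨l, h⟩
  rw [wlen_cons] at hl
  linarith

/-- A geodesic from `dsrc f`, and `f` followed by a geodesic from `dtgt f`, are different reduced
walks when neither end of `f` is reached through the other. -/
lemma two_pi_le_of_ne (hg : ENNReal.ofReal (2 * Real.pi) ≤ G.girth) {f : E × Bool} {w : V}
    (h : ∃ l, G.IsWalk (G.dtgt f) l w)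
    (h1 : G.vdist (G.dsrc f) w ≠ G.len f.1 + G.vdist (G.dtgt f) w)
    (h2 : G.vdist (G.dtgt f) w ≠ G.len f.1 + G.vdist (G.dsrc f) w) :
    2 * Real.pi ≤ G.vdist (G.dsrc f) w + G.vdist (G.dtgt f) w + G.len f.1 := by
  obtain ⟨p, hp, hplen⟩ := G.exists_geodesic (G.exists_walk_cons h)
  obtain ⟨q, hq, hqr, hqlen⟩ := exists_reduced_cons h h2
  have hne : p ≠ f :: q := by
    rintro rfl
    exact h1 (vdist_eq_of_geodesic_cons hp hplen)
  have := G.two_pi_le_add hg hp hq (G.reduced_of_geodesic hp hplen) hqr hne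
  linarith

/-- Along an edge, the distance to a vertex is monotone or has a peak of height `π`. -/
lemma DiamLEPi.peak (hS : G.DiamLEPi S) (hg : ENNReal.ofReal (2 * Real.pi) ≤ G.girth)
    {f e : E × Bool} (hf : f.1 ∈ S) (he : e.1 ∈ S)
    (h1 : G.vdist (G.dsrc f) (G.dsrc e) ≠ G.len f.1 + G.vdist (G.dtgt f) (G.dsrc e))
    (h2 : G.vdist (G.dtgt f) (G.dsrc e) ≠ G.len f.1 + G.vdist (G.dsrc f) (G.dsrc e)) :
    G.vdist (G.dsrc f) (G.dsrc e) + G.vdist (G.dtgt f) (G.dsrc e) + G.len f.1 =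
      2 * Real.pi := by
  have hf' : (opp f).1 ∈ S := hf
  have hw := hS.exists_walk hf he
  have hw' := hS.exists_walk hf' he
  rw [dsrc_opp] at hw'
  refine le_antisymm ?_ (two_pi_le_of_ne hg hw' h1 h2)
  have k1 := G.vdist_le_cons f hw'
  have k2 := G.vdist_le_cons (opp f) (by rwa [dtgt_opp])
  rw [dtgt_opp, dsrc_opp, opp_fst] at k2
  have k1 := lt_of_le_of_ne k1 h1
  have k2 := lt_of_le_of_ne k2 h2
  -- The chosen point of `f` is equally far from the target through either end; the diameter bound
  -- there gives the upper estimate.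
  rcases hS.point_vertex hf he
    (s := (G.vdist (G.dtgt f) (G.dsrc e) + G.len f.1 - G.vdist (G.dsrc f) (G.dsrc e)) / 2)
    (by linarith) (by linarith) with h | h <;> linarith

/-- In the monotone case the signs are opposite and the length is a difference of distances. At a
peak both signs are `1`, and the length is what remains of `2π`. -/
lemma DiamLEPi.len_eq (hS : G.DiamLEPi S) (hg : ENNReal.ofReal (2 * Real.pi) ≤ G.girth)
    {f e : E × Bool} (hf : f.1 ∈ S) (he : e.1 ∈ S) :
    G.len f.1 = G.slope f (G.dsrc e) * G.codist (G.dsrc f) (G.dsrc e) +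
      G.slope (opp f) (G.dsrc e) * G.codist (G.dtgt f) (G.dsrc e) := by
  have hpos := G.len_pos f.1
  by_cases h1 : G.vdist (G.dsrc f) (G.dsrc e) = G.len f.1 + G.vdist (G.dtgt f) (G.dsrc e)
  · rw [slope_of_eq h1, slope_of_ne (by rw [dsrc_opp, dtgt_opp, opp_fst]; linarith), codist,
      codist]
    linarith
  · by_cases h2 : G.vdist (G.dtgt f) (G.dsrc e) = G.len f.1 + G.vdist (G.dsrc f) (G.dsrc e)
    · rw [slope_of_ne h1, slope_of_eq (by rw [dsrc_opp, dtgt_opp, opp_fst]; linarith), codist,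
        codist]
      linarith
    · rw [slope_of_ne h1, slope_of_ne (by rwa [dsrc_opp, dtgt_opp, opp_fst]), codist, codist]
      linarith [hS.peak hg hf he h1 h2]

/-- Two different edges at a vertex cannot both start a geodesic shorter than `π`. -/
lemma DiamLEPi.slope_add_slope_nonneg (hS : G.DiamLEPi S)
    (hg : ENNReal.ofReal (2 * Real.pi) ≤ G.girth) {f f' e : E × Bool} (hf : f.1 ∈ S)
    (hf' : f'.1 ∈ S) (he : e.1 ∈ S) (hne : f ≠ f') (hsrc : G.dsrc f = G.dsrc f')
    (hx : G.codist (G.dsrc f) (G.dsrc e) ≠ 0) :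
    0 ≤ G.slope f (G.dsrc e) + G.slope f' (G.dsrc e) := by
  rcases G.slope_cases f (G.dsrc e) with h | h <;>
    rcases G.slope_cases f' (G.dsrc e) with h' | h' <;> rw [h, h'] <;> norm_num
  have hlt : G.vdist (G.dsrc f) (G.dsrc e) < Real.pi :=
    lt_of_le_of_ne (hS.vdist_le_pi hf he) fun h0 => hx (by rw [codist, h0, sub_self])
  rw [slope_eq_neg_one] at h h'
  have hw := hS.exists_walk (d := opp f) hf he
  have hw' := hS.exists_walk (d := opp f') hf' he
  rw [dsrc_opp] at hw hw'
  obtain ⟨p, hp, hpl⟩ := G.exists_geodesic hw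
  obtain ⟨p', hp', hpl'⟩ := G.exists_geodesic hw'
  have q : G.IsWalk (G.dsrc f) (f :: p) (G.dsrc e) := ⟨rfl, hp⟩
  have q' : G.IsWalk (G.dsrc f) (f' :: p') (G.dsrc e) := ⟨hsrc.symm, hp'⟩
  have ql : G.wlen (f :: p) = G.vdist (G.dsrc f) (G.dsrc e) := by rw [wlen_cons, hpl, h]
  have ql' : G.wlen (f' :: p') = G.vdist (G.dsrc f) (G.dsrc e) := by
    rw [wlen_cons, hpl', hsrc, h']
  have := G.two_pi_le_add hg q q' (G.reduced_of_geodesic q ql) (G.reduced_of_geodesic q' ql')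
    (fun hh => hne (List.cons.inj hh).1)
  linarith

/-- If the distance to `dsrc f` increases along `e`, then `f` points towards the initial vertex of
`e` if and only if it points towards its terminal vertex. -/
lemma DiamLEPi.slope_eq_of_mono (hS : G.DiamLEPi S)
    (hg : ENNReal.ofReal (2 * Real.pi) ≤ G.girth) {f e : E × Bool} (hf : f.1 ∈ S) (he : e.1 ∈ S)
    (hne : f.1 ≠ e.1) (hx : G.codist (G.dsrc f) (G.dtgt e) ≠ 0)
    (hm : G.vdist (G.dsrc f) (G.dtgt e) = G.vdist (G.dsrc f) (G.dsrc e) + G.len e.1) :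
    G.slope f (G.dsrc e) = G.slope f (G.dtgt e) := by
  have hw0 := hS.exists_walk hf he
  have hw := hS.exists_walk (d := opp f) hf he
  have hw' := hS.exists_walk (d := opp f) (d' := opp e) hf he
  rw [dsrc_opp] at hw
  rw [dsrc_opp, dsrc_opp] at hw'
  have hle := hS.vdist_le_pi (d := f) (d' := opp e) hf he
  rw [dsrc_opp] at hle
  have hlt : G.vdist (G.dsrc f) (G.dtgt e) < Real.pi :=
    lt_of_le_of_ne hle fun h0 => hx (by rw [codist, h0, sub_self])
  obtain ⟨p, hp, hpl⟩ := G.exists_geodesic hw0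
  have hp1 : G.IsWalk (G.dsrc f) (p ++ [e]) (G.dtgt e) :=
    (G.isWalk_append).2 ⟨_, hp, rfl, rfl⟩
  have hpl1 : G.wlen (p ++ [e]) = G.vdist (G.dsrc f) (G.dtgt e) := by
    rw [wlen_append, wlen_cons, wlen_nil, hpl, hm, add_zero]
  have key : G.slope f (G.dsrc e) = -1 ↔ G.slope f (G.dtgt e) = -1 := by
    rw [slope_eq_neg_one, slope_eq_neg_one]
    constructor
    · intro h
      refine le_antisymm (G.vdist_le_cons f hw') ?_
      have h1 : G.vdist (G.dtgt f) (G.dtgt e) ≤ G.vdist (G.dtgt f) (G.dsrc e) + G.len e.1 := by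
        obtain ⟨q, hq, hql⟩ := G.exists_geodesic hw
        have he' : G.IsWalk (G.dsrc e) [e] (G.dtgt e) := ⟨rfl, rfl⟩
        have := G.vdist_le ((G.isWalk_append).2 ⟨_, hq, he'⟩)
        rwa [wlen_append, hql, wlen_cons, wlen_nil, add_zero] at this
      linarith
    · intro h
      obtain ⟨q, hq, hql⟩ := G.exists_geodesic hw'
      have hq1 : G.IsWalk (G.dsrc f) (f :: q) (G.dtgt e) := ⟨rfl, hq⟩
      have hql1 : G.wlen (f :: q) = G.vdist (G.dsrc f) (G.dtgt e) := by rw [wlen_cons, hql, h]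
      -- Both walks are geodesics shorter than `π`, hence equal; as `f` and `e` are different edges,
      -- `f` already starts the part leading to `dsrc e`.
      have heq : p ++ [e] = f :: q := by
        by_contra hcon
        have := G.two_pi_le_add hg hp1 hq1 (G.reduced_of_geodesic hp1 hpl1)
          (G.reduced_of_geodesic hq1 hql1) hcon
        linarith
      cases p with
      | nil => exact absurd (by rw [(List.cons.inj heq).1]) hne
      | cons d p =>
        obtain rfl : d = f := (List.cons.inj heq).1
        exact vdist_eq_of_geodesic_cons hp hpl
  rcases G.slope_cases f (G.dsrc e) with h | h <;>
    rcases G.slope_cases f (G.dtgt e) with h' | h' <;> rw [h, h'] at key ⊢ <;> norm_num at key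

/-- If the distance to `dsrc f` has a peak in the interior of `e`, then `f` points towards exactly
one of the endpoints of `e`. -/
lemma DiamLEPi.slope_add_of_peak (hS : G.DiamLEPi S)
    (hg : ENNReal.ofReal (2 * Real.pi) ≤ G.girth) {f e : E × Bool} (hf : f.1 ∈ S) (he : e.1 ∈ S)
    (hne : f.1 ≠ e.1) (hx : G.codist (G.dsrc f) (G.dsrc e) ≠ 0)
    (hx' : G.codist (G.dsrc f) (G.dtgt e) ≠ 0)
    (h1 : G.vdist (G.dsrc f) (G.dtgt e) ≠ G.vdist (G.dsrc f) (G.dsrc e) + G.len e.1)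
    (h2 : G.vdist (G.dsrc f) (G.dsrc e) ≠ G.vdist (G.dsrc f) (G.dtgt e) + G.len e.1) :
    G.slope f (G.dsrc e) + G.slope f (G.dtgt e) = 0 := by
  have hpk : G.vdist (G.dsrc f) (G.dsrc e) + G.vdist (G.dsrc f) (G.dtgt e) + G.len e.1 =
      2 * Real.pi := by
    have := hS.peak hg (f := e) (e := f) he hf
    rw [G.vdist_comm (G.dsrc e), G.vdist_comm (G.dtgt e)] at this
    exact this (fun h => h2 (by linarith)) (fun h => h1 (by linarith))
  have hle := hS.vdist_le_pi hf he
  have hle' := hS.vdist_le_pi (d := f) (d' := opp e) hf he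
  rw [dsrc_opp] at hle'
  have hlt := lt_of_le_of_ne hle fun h0 => hx (by rw [codist, h0, sub_self])
  have hlt' := lt_of_le_of_ne hle' fun h0 => hx' (by rw [codist, h0, sub_self])
  have hw := hS.exists_walk (d := opp f) hf he
  have hw' := hS.exists_walk (d := opp f) (d' := opp e) hf he
  rw [dsrc_opp] at hw
  rw [dsrc_opp, dsrc_opp] at hw'
  rcases G.slope_cases f (G.dsrc e) with h | h <;>
    rcases G.slope_cases f (G.dtgt e) with h' | h' <;> rw [h, h'] <;> norm_num
  · exfalso
    have n1 : G.vdist (G.dsrc f) (G.dsrc e) ≠ G.len f.1 + G.vdist (G.dtgt f) (G.dsrc e) :=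
      fun hh => by rw [slope_of_eq hh] at h; norm_num at h
    have n2 : G.vdist (G.dsrc f) (G.dtgt e) ≠ G.len f.1 + G.vdist (G.dtgt f) (G.dtgt e) :=
      fun hh => by rw [slope_of_eq hh] at h'; norm_num at h'
    have m1 := lt_of_le_of_ne (G.vdist_le_cons f hw) n1
    have m2 := lt_of_le_of_ne (G.vdist_le_cons f hw') n2
    -- If `f` points towards neither end of `e`, a small move by `δ` along `f` increases the
    -- distance to both ends. The point of `e` at the peak, at distance `π` from `dsrc f`, would
    -- then be farther than `π`.
    obtain ⟨δ, hδ0, hδ⟩ := exists_between (lt_min (G.len_pos f.1)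
      (lt_min (sub_pos.2 m1) (sub_pos.2 m2)))
    simp only [lt_min_iff] at hδ
    rcases hS.point_point hf he hne (s := δ) (t := Real.pi - G.vdist (G.dsrc f) (G.dsrc e))
      hδ0 hδ.1 (by linarith) (by linarith) with (h | h) | (h | h) <;> linarith
  · exfalso
    rw [slope_eq_neg_one] at h h'
    -- If `f` points towards both ends of `e`, starting from `dtgt f` instead shortens both routes
    -- by `len f`. Two different reduced walks from `dsrc e` to `dtgt f` then have total length `2π
    -- - 2 * len f`, which is too short.
    obtain ⟨p, hp, hpl⟩ := G.exists_geodesic hw'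
    obtain ⟨q, hq, hqr, hql⟩ := exists_reduced_cons (f := e) (w := G.dtgt f)
      (by obtain ⟨l, hl⟩ := hw'; exact ⟨_, hl.revWalk⟩)
      (by
        rw [G.vdist_comm (G.dtgt e), G.vdist_comm (G.dsrc e)]
        intro hh; exact h1 (by linarith))
    obtain ⟨r, hr, hrl⟩ := G.exists_geodesic hw
    have hne' : revWalk r ≠ e :: q := by
      intro hh
      have hr' := hr.revWalk
      have hrl' : G.wlen (revWalk r) = G.vdist (G.dsrc e) (G.dtgt f) := by
        rw [wlen_revWalk, hrl, vdist_comm]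
      rw [hh] at hr' hrl'
      have := vdist_eq_of_geodesic_cons hr' hrl'
      rw [G.vdist_comm (G.dtgt e), G.vdist_comm (G.dsrc e)] at this
      exact h2 (by linarith)
    have := G.two_pi_le_add hg hr.revWalk hq (G.reduced_of_geodesic hr hrl).revWalk hqr hne'
    rw [wlen_revWalk, hrl, hql, G.vdist_comm (G.dtgt e)] at this
    linarith [G.len_pos f.1]

/-- The relation between the signs at the two ends of a side of the rectangle `f × e`. -/
lemma DiamLEPi.side (hS : G.DiamLEPi S) (hg : ENNReal.ofReal (2 * Real.pi) ≤ G.girth)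
    {f e : E × Bool} (hf : f.1 ∈ S) (he : e.1 ∈ S) (hne : f.1 ≠ e.1) :
    G.codist (G.dsrc f) (G.dsrc e) = 0 ∨ G.codist (G.dsrc f) (G.dtgt e) = 0 ∨
      G.slope f (G.dsrc e) * G.slope (opp e) (G.dsrc f) +
        G.slope f (G.dtgt e) * G.slope e (G.dsrc f) = 0 := by
  by_cases hx : G.codist (G.dsrc f) (G.dsrc e) = 0
  · exact .inl hx
  by_cases hx' : G.codist (G.dsrc f) (G.dtgt e) = 0
  · exact .inr (.inl hx')
  refine .inr (.inr ?_)
  have hpos := G.len_pos e.1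
  have s1 : G.vdist (G.dsrc f) (G.dsrc e) = G.vdist (G.dsrc f) (G.dtgt e) + G.len e.1 →
      G.slope e (G.dsrc f) = -1 := fun h => slope_of_eq (by
    rw [G.vdist_comm (G.dsrc e), G.vdist_comm (G.dtgt e)]; linarith)
  have s1' : G.vdist (G.dsrc f) (G.dsrc e) ≠ G.vdist (G.dsrc f) (G.dtgt e) + G.len e.1 →
      G.slope e (G.dsrc f) = 1 := fun h => slope_of_ne (by
    rw [G.vdist_comm (G.dsrc e), G.vdist_comm (G.dtgt e)]; intro hh; exact h (by linarith))
  have s2 : G.vdist (G.dsrc f) (G.dtgt e) = G.vdist (G.dsrc f) (G.dsrc e) + G.len e.1 →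
      G.slope (opp e) (G.dsrc f) = -1 := fun h => slope_of_eq (by
    rw [dsrc_opp, dtgt_opp, opp_fst, G.vdist_comm (G.dsrc e), G.vdist_comm (G.dtgt e)]; linarith)
  have s2' : G.vdist (G.dsrc f) (G.dtgt e) ≠ G.vdist (G.dsrc f) (G.dsrc e) + G.len e.1 →
      G.slope (opp e) (G.dsrc f) = 1 := fun h => slope_of_ne (by
    rw [dsrc_opp, dtgt_opp, opp_fst, G.vdist_comm (G.dsrc e), G.vdist_comm (G.dtgt e)]
    intro hh; exact h (by linarith))
  by_cases h1 : G.vdist (G.dsrc f) (G.dtgt e) = G.vdist (G.dsrc f) (G.dsrc e) + G.len e.1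
  · rw [s2 h1, s1' (by linarith), hS.slope_eq_of_mono hg hf he hne hx' h1]
    ring
  · by_cases h2 : G.vdist (G.dsrc f) (G.dsrc e) = G.vdist (G.dsrc f) (G.dtgt e) + G.len e.1
    · have := hS.slope_eq_of_mono hg (e := opp e) hf he hne (by rwa [dtgt_opp])
        (by rw [dsrc_opp, dtgt_opp, opp_fst]; exact h2)
      rw [dsrc_opp, dtgt_opp] at this
      rw [s1 h2, s2' h1, this]
      ring
    · rw [s1' h2, s2' h1]
      linarith [hS.slope_add_of_peak hg hf he hne hx hx' h1 h2]

end MetricGraph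

/-! ### Bilinear identities for rectangles, squares and tori -/

namespace MetricGraph

variable {V E : Type*} (G : MetricGraph V E)

/-- The contribution of a corner of a rectangle `f × e` to the identity `DiamLEPi.rectangle`. -/
noncomputable def corner (φ ψ : ℝ →+ ℝ) (f e : E × Bool) : ℝ :=
  G.slope f (G.dsrc e) * G.slope e (G.dsrc f) *
    (φ (G.codist (G.dsrc f) (G.dsrc e)) * ψ (G.codist (G.dsrc f) (G.dsrc e)))

variable {G} {S : Set E}

lemma DiamLEPi.map_len (hS : G.DiamLEPi S) (hg : ENNReal.ofReal (2 * Real.pi) ≤ G.girth)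
    (φ : ℝ →+ ℝ) {f e : E × Bool} (hf : f.1 ∈ S) (he : e.1 ∈ S) :
    φ (G.len f.1) = G.slope f (G.dsrc e) * φ (G.codist (G.dsrc f) (G.dsrc e)) +
      G.slope (opp f) (G.dsrc e) * φ (G.codist (G.dtgt f) (G.dsrc e)) := by
  conv_lhs => rw [hS.len_eq hg hf he]
  rw [map_add, map_slope_mul, map_slope_mul]

/-- Each factor is expanded by `DiamLEPi.map_len` as seen from either end of the other edge, and the
expansions are averaged. Symmetrising in `φ` and `ψ` gives the mixed products exactly the sign
combinations of `DiamLEPi.side`. -/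
lemma DiamLEPi.rectangle (hS : G.DiamLEPi S) (hg : ENNReal.ofReal (2 * Real.pi) ≤ G.girth)
    (φ ψ : ℝ →+ ℝ) {f e : E × Bool} (hf : f.1 ∈ S) (he : e.1 ∈ S) (hne : f.1 ≠ e.1) :
    φ (G.len f.1) * ψ (G.len e.1) + ψ (G.len f.1) * φ (G.len e.1) =
      G.corner φ ψ f e + G.corner φ ψ (opp f) e + G.corner φ ψ f (opp e) +
        G.corner φ ψ (opp f) (opp e) := by
  have a1 := fun χ => hS.map_len hg χ hf he
  have a2 := fun χ => hS.map_len hg χ (e := opp e) hf he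
  have b1 := fun χ => hS.map_len hg χ he hf
  have b2 := fun χ => hS.map_len hg χ (e := opp f) he hf
  have s1 := hS.side hg hf he hne
  have s2 := hS.side hg (f := opp f) hf he hne
  simp only [corner, dsrc_opp, G.codist_comm (G.dsrc e), G.codist_comm (G.dtgt e)]
    at *
  generalize G.codist (G.dsrc f) (G.dsrc e) = x00 at *
  generalize G.codist (G.dsrc f) (G.dtgt e) = x01 at *
  generalize G.codist (G.dtgt f) (G.dsrc e) = x10 at *
  generalize G.codist (G.dtgt f) (G.dtgt e) = x11 at *
  generalize G.slope f (G.dsrc e) = p00 at *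
  generalize G.slope f (G.dtgt e) = p01 at *
  generalize G.slope (opp f) (G.dsrc e) = p10 at *
  generalize G.slope (opp f) (G.dtgt e) = p11 at *
  generalize G.slope e (G.dsrc f) = q00 at *
  generalize G.slope (opp e) (G.dsrc f) = q01 at *
  generalize G.slope e (G.dtgt f) = q10 at *
  generalize G.slope (opp e) (G.dtgt f) = q11 at *
  -- A mixed term vanishes either by the sign relation or because one codistance is zero and
  -- additive maps kill it.
  have c1 : (p00 * q01 + p01 * q00) * (φ x00 * ψ x01) = 0 ∧
      (p00 * q01 + p01 * q00) * (ψ x00 * φ x01) = 0 := by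
    rcases s1 with rfl | rfl | h <;> simp [*]
  have c2 : (p10 * q11 + p11 * q10) * (φ x10 * ψ x11) = 0 ∧
      (p10 * q11 + p11 * q10) * (ψ x10 * φ x11) = 0 := by
    rcases s2 with rfl | rfl | h <;> simp [*]
  linear_combination (1 / 2) * ((a1 φ + a2 φ) * ψ (G.len e.1) + (a1 ψ + a2 ψ) * φ (G.len e.1) +
    (p00 * φ x00 + p01 * φ x01) * b1 ψ + (p10 * φ x10 + p11 * φ x11) * b2 ψ +
    (p00 * ψ x00 + p01 * ψ x01) * b1 φ + (p10 * ψ x10 + p11 * ψ x11) * b2 φ +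
    c1.1 + c1.2 + c2.1 + c2.2)

/-- On the diagonal, paths inside the edge invalidate the rectangle identity. The corners can be
computed directly: two have codistance `π`, and the other two have codistance `±(len - π)`. -/
lemma DiamLEPi.square (hS : G.DiamLEPi S) (hg : ENNReal.ofReal (2 * Real.pi) ≤ G.girth)
    (φ ψ : ℝ →+ ℝ) {f e : E × Bool} (hf : f.1 ∈ S) (he : f.1 = e.1) :
    φ (G.len f.1) * ψ (G.len e.1) + ψ (G.len f.1) * φ (G.len e.1) =
      G.corner φ ψ f e + G.corner φ ψ (opp f) e + G.corner φ ψ f (opp e) +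
        G.corner φ ψ (opp f) (opp e) - 4 * (φ Real.pi * ψ Real.pi) +
        2 * (φ (G.len f.1) * ψ Real.pi + ψ (G.len f.1) * φ Real.pi) := by
  have c1 : ∀ d : E × Bool, G.corner φ ψ d d = φ Real.pi * ψ Real.pi := fun d => by
    simp [corner, slope_self]
  have hslope : G.slope (opp f) (G.dsrc f) = G.slope f (G.dtgt f) := by
    simp only [slope, dsrc_opp, dtgt_opp, opp_fst, vdist_self, G.vdist_comm (G.dtgt f)]
  have hlen := fun χ => hS.map_len hg χ hf hf
  simp only [slope_self, codist_self, one_mul] at hlen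
  have c2 : G.corner φ ψ f (opp f) = (φ (G.len f.1) - φ Real.pi) * (ψ (G.len f.1) - ψ Real.pi) := by
    rw [hlen φ, hlen ψ, corner, dsrc_opp, hslope, G.codist_comm (G.dtgt f)]
    rcases G.slope_cases f (G.dtgt f) with h | h <;> rw [h] <;> ring
  have c3 : G.corner φ ψ (opp f) f = G.corner φ ψ f (opp f) := by
    rw [corner, corner, dsrc_opp, G.codist_comm (G.dtgt f)]; ring
  rcases eq_or_eq_opp he.symm with rfl | rfl
  · rw [c1, c1, c3, c2]; ring
  · rw [opp_opp, c1, c1, c3, c2, opp_fst]; ring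

lemma sum_add_one {n : ℕ} [NeZero n] (F : Fin n → ℝ) : ∑ i, F (i + 1) = ∑ i, F i :=
  Equiv.sum_comp (Equiv.addRight (1 : Fin n)) F

open scoped Classical in
/-- The bilinear identity for two closed immersed edge-paths: the bilinear area of the torus
`C × C'` is a sum of bilinear areas of squares and of strips of width `π`. -/
lemma DiamLEPi.torus (hS : G.DiamLEPi S) (hg : ENNReal.ofReal (2 * Real.pi) ≤ G.girth)
    {n m : ℕ} [NeZero n] [NeZero m] (f : Fin n → E × Bool) (g : Fin m → E × Bool)
    (hfS : ∀ i, (f i).1 ∈ S) (hgS : ∀ j, (g j).1 ∈ S)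
    (hf : ∀ i, G.dtgt (f i) = G.dsrc (f (i + 1))) (hg' : ∀ j, G.dtgt (g j) = G.dsrc (g (j + 1)))
    (hfr : ∀ i, f (i + 1) ≠ opp (f i)) (hgr : ∀ j, g (j + 1) ≠ opp (g j)) :
    ∃ (c x : Fin n → Fin m → ℝ), (∀ i j, 0 ≤ c i j) ∧ ∀ φ ψ : ℝ →+ ℝ,
      φ (∑ i, G.len (f i).1) * ψ (∑ j, G.len (g j).1) +
        ψ (∑ i, G.len (f i).1) * φ (∑ j, G.len (g j).1) =
      ∑ i, ∑ j, c i j * (φ (x i j) * ψ (x i j)) +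
        2 * (φ (∑ i, ∑ j, if (f i).1 = (g j).1 then G.len (f i).1 else 0) * ψ Real.pi +
          ψ (∑ i, ∑ j, if (f i).1 = (g j).1 then G.len (f i).1 else 0) * φ Real.pi) := by
  have hf1 : ∀ i, G.dtgt (f (i - 1)) = G.dsrc (f i) := fun i => by rw [hf, sub_add_cancel]
  have hg1 : ∀ j, G.dtgt (g (j - 1)) = G.dsrc (g j) := fun j => by rw [hg', sub_add_cancel]
  have hfr1 : ∀ i, f i ≠ opp (f (i - 1)) := fun i => by
    have := hfr (i - 1); rwa [sub_add_cancel] at this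
  have hgr1 : ∀ j, g j ≠ opp (g (j - 1)) := fun j => by
    have := hgr (j - 1); rwa [sub_add_cancel] at this
  let x : Fin n → Fin m → ℝ := fun i j => G.codist (G.dsrc (f i)) (G.dsrc (g j))
  -- The four corners meeting at a vertex of the torus share the same codistance, so their signs
  -- factor as a product of two sums. Each `4` absorbs the `4 * (φ π * ψ π)` of a coincidence
  -- square, moved to a corner where the codistance is `π`.
  let u : Fin n → Fin m → ℝ := fun i j =>
    (G.slope (f i) (G.dsrc (g j)) + G.slope (opp (f (i - 1))) (G.dsrc (g j))) *
      (G.slope (g j) (G.dsrc (f i)) + G.slope (opp (g (j - 1))) (G.dsrc (f i))) -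
      (if f i = g j then 4 else 0) - (if f i = opp (g (j - 1)) then 4 else 0)
  -- The sign of `u i j` is not controlled when `x i j = 0`, but additive maps vanish there, so the
  -- coefficient may be replaced by `0`.
  refine ⟨fun i j => if x i j = 0 then 0 else u i j, x, fun i j => ?_, fun φ ψ => ?_⟩
  · dsimp only
    split_ifs with h0
    · exact le_rfl
    have h1 := hS.slope_add_slope_nonneg hg (f' := opp (f (i - 1))) (hfS i) (hfS (i - 1)) (hgS j)
      (hfr1 i) (by rw [dsrc_opp, hf1]) h0
    have h2 := hS.slope_add_slope_nonneg hg (f' := opp (g (j - 1))) (hgS j) (hgS (j - 1)) (hfS i)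
      (hgr1 j) (by rw [dsrc_opp, hg1]) (by rwa [codist_comm])
    -- At coinciding vertices all four slopes are `1`, so the product is `4`. At most one correction
    -- is subtracted, since `g` does not backtrack.
    have hself : G.dsrc (f i) = G.dsrc (g j) → u i j =
        4 - (if f i = g j then 4 else 0) - (if f i = opp (g (j - 1)) then 4 else 0) := by
      intro hv
      have e1 := slope_self (G := G) (f i)
      have e2 := slope_self (G := G) (opp (f (i - 1)))
      have e3 := slope_self (G := G) (g j)
      have e4 := slope_self (G := G) (opp (g (j - 1)))
      rw [dsrc_opp, hf1] at e2
      rw [dsrc_opp, hg1] at e4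
      rw [hv] at e1 e2
      rw [← hv] at e3 e4
      simp only [u, e1, e2, e3, e4]
      norm_num
    by_cases k1 : f i = g j
    · have k2 : f i ≠ opp (g (j - 1)) := by rw [k1]; exact hgr1 j
      rw [hself (by rw [k1]), if_pos k1, if_neg k2]
      norm_num
    · by_cases k2 : f i = opp (g (j - 1))
      · rw [hself (by rw [k2, dsrc_opp, hg1]), if_neg k1, if_pos k2]
        norm_num
      · simp only [u, if_neg k1, if_neg k2, sub_zero]
        exact mul_nonneg h1 h2
  · have hrect : ∀ i j, φ (G.len (f i).1) * ψ (G.len (g j).1) +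
        ψ (G.len (f i).1) * φ (G.len (g j).1) =
        G.corner φ ψ (f i) (g j) + G.corner φ ψ (opp (f i)) (g j) +
          G.corner φ ψ (f i) (opp (g j)) + G.corner φ ψ (opp (f i)) (opp (g j)) -
        (if f i = g j then 4 else 0) * (φ Real.pi * ψ Real.pi) -
        (if f i = opp (g j) then 4 else 0) * (φ Real.pi * ψ Real.pi) +
        2 * (φ (if (f i).1 = (g j).1 then G.len (f i).1 else 0) * ψ Real.pi +
          ψ (if (f i).1 = (g j).1 then G.len (f i).1 else 0) * φ Real.pi) := by
      intro i j
      by_cases h : (f i).1 = (g j).1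
      · rw [hS.square hg φ ψ (hfS i) h, if_pos h]
        rcases eq_or_eq_opp h with k | k
        · rw [if_pos k, if_neg (by rw [k]; exact (opp_ne _).symm)]; ring
        · rw [if_pos k, if_neg (by rw [k]; exact opp_ne _)]; ring
      · rw [hS.rectangle hg φ ψ (hfS i) (hgS j) h, if_neg h, if_neg (fun k => h (by rw [k])),
          if_neg (fun k => h (by rw [k, opp_fst]))]
        simp
    have hu : ∀ i j, (if x i j = 0 then 0 else u i j) * (φ (x i j) * ψ (x i j)) =
        G.corner φ ψ (f i) (g j) + G.corner φ ψ (opp (f (i - 1))) (g j) +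
          G.corner φ ψ (f i) (opp (g (j - 1))) +
          G.corner φ ψ (opp (f (i - 1))) (opp (g (j - 1))) -
        (if f i = g j then 4 else 0) * (φ Real.pi * ψ Real.pi) -
        (if f i = opp (g (j - 1)) then 4 else 0) * (φ Real.pi * ψ Real.pi) := by
      intro i j
      have k0 : (if x i j = 0 then 0 else u i j) * (φ (x i j) * ψ (x i j)) =
          u i j * (φ (x i j) * ψ (x i j)) := by
        split_ifs with h
        · rw [h]; simp
        · rfl
      have k1 : (if f i = g j then (4 : ℝ) else 0) * (φ Real.pi * ψ Real.pi) =
          (if f i = g j then 4 else 0) * (φ (x i j) * ψ (x i j)) := by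
        split_ifs with h
        · simp [x, h]
        · simp
      have k2 : (if f i = opp (g (j - 1)) then (4 : ℝ) else 0) * (φ Real.pi * ψ Real.pi) =
          (if f i = opp (g (j - 1)) then 4 else 0) * (φ (x i j) * ψ (x i j)) := by
        split_ifs with h
        · simp [x, h, hg1]
        · simp
      rw [k0, k1, k2]
      simp only [corner, dsrc_opp, hf1, hg1, u, x]
      ring
    have hL : φ (∑ i, G.len (f i).1) * ψ (∑ j, G.len (g j).1) +
        ψ (∑ i, G.len (f i).1) * φ (∑ j, G.len (g j).1) =
        ∑ i, ∑ j, (φ (G.len (f i).1) * ψ (G.len (g j).1) +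
          ψ (G.len (f i).1) * φ (G.len (g j).1)) := by
      simp only [map_sum, Finset.sum_mul_sum, Finset.sum_add_distrib]
    -- Cyclic reindexing regroups the corners of each rectangle around the vertices of the torus.
    have s2 : ∑ i, ∑ j, G.corner φ ψ (opp (f i)) (g j) =
        ∑ i, ∑ j, G.corner φ ψ (opp (f (i - 1))) (g j) := by
      rw [← sum_add_one (fun i => ∑ j, G.corner φ ψ (opp (f (i - 1))) (g j))]
      simp only [add_sub_cancel_right]
    have s3 : ∑ i, ∑ j, G.corner φ ψ (f i) (opp (g j)) =
        ∑ i, ∑ j, G.corner φ ψ (f i) (opp (g (j - 1))) := by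
      refine Finset.sum_congr rfl fun i _ => ?_
      rw [← sum_add_one (fun j => G.corner φ ψ (f i) (opp (g (j - 1))))]
      simp only [add_sub_cancel_right]
    have s4 : ∑ i, ∑ j, G.corner φ ψ (opp (f i)) (opp (g j)) =
        ∑ i, ∑ j, G.corner φ ψ (opp (f (i - 1))) (opp (g (j - 1))) := by
      rw [← sum_add_one (fun i => ∑ j, G.corner φ ψ (opp (f (i - 1))) (opp (g (j - 1))))]
      refine Finset.sum_congr rfl fun i _ => ?_
      rw [← sum_add_one (fun j => G.corner φ ψ (opp (f (i + 1 - 1))) (opp (g (j - 1))))]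
      simp only [add_sub_cancel_right]
    have s5 : ∑ i, ∑ j, (if f i = opp (g j) then (4 : ℝ) else 0) * (φ Real.pi * ψ Real.pi) =
        ∑ i, ∑ j, (if f i = opp (g (j - 1)) then 4 else 0) * (φ Real.pi * ψ Real.pi) := by
      refine Finset.sum_congr rfl fun i _ => ?_
      rw [← sum_add_one (fun j => (if f i = opp (g (j - 1)) then (4 : ℝ) else 0) *
        (φ Real.pi * ψ Real.pi))]
      simp only [add_sub_cancel_right]
    rw [hL]
    simp only [hrect, hu, map_sum, Finset.sum_add_distrib, Finset.sum_sub_distrib, s2, s3, s4, s5,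
      Finset.sum_mul, Finset.mul_sum, mul_add]

end MetricGraph

/-! ### Dehn's argument and the induction on closed walks -/

namespace MetricGraph

variable {V E : Type*} (G : MetricGraph V E)

/-- The list of directed edges of a closed immersed edge-path. -/
def ClosedReduced (l : List (E × Bool)) : Prop :=
  l ≠ [] ∧ (∃ v, G.IsWalk v l v) ∧ Reduced (l ++ l)

open scoped Classical in
/-- The total length of the coincidences between the edges of two lists. -/
noncomputable def overlap (l l' : List (E × Bool)) : ℝ :=
  (l.map fun a => (l'.map fun b => if a.1 = b.1 then G.len a.1 else 0).sum).sum

lemma overlap_append_right (l l₁ l₂ : List (E × Bool)) :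
    G.overlap l (l₁ ++ l₂) = G.overlap l l₁ + G.overlap l l₂ := by
  simp only [overlap, List.map_append, List.sum_append, List.sum_map_add]

lemma overlap_eq_zero {l l' : List (E × Bool)} (h : ∀ a ∈ l, ∀ b ∈ l', a.1 ≠ b.1) :
    G.overlap l l' = 0 := by
  refine List.sum_eq_zero fun x hx => ?_
  obtain ⟨a, ha, rfl⟩ := List.mem_map.1 hx
  refine List.sum_eq_zero fun y hy => ?_
  obtain ⟨b, hb, rfl⟩ := List.mem_map.1 hy
  exact if_neg (h a ha b hb)

open scoped Classical in
lemma overlap_eq_sum (l l' : List (E × Bool)) :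
    G.overlap l l' =
      ∑ i : Fin l.length, ∑ j : Fin l'.length, if l[i].1 = l'[j].1 then G.len l[i].1 else 0 := by
  rw [overlap, ← Fin.sum_univ_fun_getElem]
  refine Finset.sum_congr rfl fun i _ => ?_
  rw [← Fin.sum_univ_fun_getElem]
  rfl

variable {G} {S : Set E}

lemma DiamLEPi.torus_list (hS : G.DiamLEPi S) (hg : ENNReal.ofReal (2 * Real.pi) ≤ G.girth)
    {l l' : List (E × Bool)} (hl : G.ClosedReduced l) (hl' : G.ClosedReduced l')
    (hlS : ∀ d ∈ l, d.1 ∈ S) (hlS' : ∀ d ∈ l', d.1 ∈ S) :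
    ∃ (c x : Fin l.length → Fin l'.length → ℝ), (∀ i j, 0 ≤ c i j) ∧ ∀ φ ψ : ℝ →+ ℝ,
      φ (G.wlen l) * ψ (G.wlen l') + ψ (G.wlen l) * φ (G.wlen l') =
      ∑ i, ∑ j, c i j * (φ (x i j) * ψ (x i j)) +
        2 * (φ (G.overlap l l') * ψ Real.pi + ψ (G.overlap l l') * φ Real.pi) := by
  obtain ⟨hne, ⟨v, hw⟩, hr⟩ := hl
  obtain ⟨hne', ⟨v', hw'⟩, hr'⟩ := hl'
  have : NeZero l.length := ⟨by simpa using hne⟩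
  have : NeZero l'.length := ⟨by simpa using hne'⟩
  have := hS.torus hg (fun i : Fin l.length => l[i]) (fun j : Fin l'.length => l'[j])
    (fun i => hlS _ (List.getElem_mem _)) (fun i => hlS' _ (List.getElem_mem _))
    (hw.dtgt_cyclic G) (hw'.dtgt_cyclic G) hr.ne_cyclic hr'.ne_cyclic
  rw [G.sum_getElem_len, G.sum_getElem_len] at this
  simpa only [overlap_eq_sum] using this

/-- For an additive function vanishing at `π` and at the length of `l`, only the strips of the
torus identity contribute. -/
lemma DiamLEPi.len_mul (hS : G.DiamLEPi S) (hg : ENNReal.ofReal (2 * Real.pi) ≤ G.girth)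
    {l l' : List (E × Bool)} (hl : G.ClosedReduced l) (hl' : G.ClosedReduced l')
    (hlS : ∀ d ∈ l, d.1 ∈ S) (hlS' : ∀ d ∈ l', d.1 ∈ S) {φ : ℝ →+ ℝ} (hπ : φ Real.pi = 0)
    (h0 : φ (G.wlen l) = 0) :
    G.wlen l * φ (G.wlen l') = 2 * Real.pi * φ (G.overlap l l') := by
  obtain ⟨c, x, hc, h⟩ := hS.torus_list hg hl hl' hlS hlS'
  have h1 := h φ φ
  rw [h0, hπ] at h1
  have h2 : ∑ i, ∑ j, c i j * (φ (x i j) * φ (x i j)) = 0 := by linarith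
  have hnn : ∀ i j, 0 ≤ c i j * (φ (x i j) * φ (x i j)) := fun i j =>
    mul_nonneg (hc i j) (mul_self_nonneg _)
  have h3 : ∀ i j, c i j * φ (x i j) = 0 := by
    intro i j
    have k1 := (Finset.sum_eq_zero_iff_of_nonneg
      (fun i _ => Finset.sum_nonneg fun j _ => hnn i j)).1 h2 i (Finset.mem_univ i)
    have k2 := (Finset.sum_eq_zero_iff_of_nonneg (fun j _ => hnn i j)).1 k1 j (Finset.mem_univ j)
    simpa using k2
  -- The coefficients do not depend on `φ`, `ψ`: the case `ψ = φ` kills every `c i j * φ (x i j)`,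
  -- so the square terms also vanish for `ψ = id`.
  have h4 := h φ (AddMonoidHom.id ℝ)
  simp only [AddMonoidHom.id_apply, ← mul_assoc, h3, zero_mul, Finset.sum_const_zero, h0, hπ] at h4
  linarith

lemma ClosedReduced.rotate {u v : List (E × Bool)} (h : G.ClosedReduced (u ++ v)) :
    G.ClosedReduced (v ++ u) := by
  obtain ⟨hne, ⟨x, hw⟩, hr⟩ := h
  obtain ⟨y, h1, h2⟩ := (G.isWalk_append).1 hw
  refine ⟨by simpa [and_comm] using hne, ⟨y, (G.isWalk_append).2 ⟨x, h2, h1⟩⟩, ?_⟩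
  rcases eq_or_ne u [] with rfl | hu
  · simpa using hr
  rcases eq_or_ne v [] with rfl | hv
  · simpa using hr
  simp only [reduced_append] at hr ⊢
  obtain ⟨⟨r1, r2, r3⟩, -, r4⟩ := hr
  rw [List.head?_append_of_ne_nil _ hu, List.getLast?_append_of_ne_nil _ hv] at r4
  refine ⟨⟨r2, r1, r4⟩, ⟨r2, r1, r4⟩, ?_⟩
  rw [List.head?_append_of_ne_nil _ hv, List.getLast?_append_of_ne_nil _ hu]
  exact r3

lemma ClosedReduced.reduced {l : List (E × Bool)} (h : G.ClosedReduced l) : Reduced l :=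
  (reduced_append.1 h.2.2).1

lemma ClosedReduced.of_append_cons {a : E × Bool} {u v : List (E × Bool)}
    (h : G.ClosedReduced (a :: u ++ a :: v)) : G.ClosedReduced (a :: u) := by
  obtain ⟨-, ⟨x, hw⟩, hr⟩ := h
  obtain ⟨y, h1, h2⟩ := (G.isWalk_append).1 hw
  obtain rfl : x = y := h1.1.symm.trans h2.1
  have hr' := (reduced_append.1 hr).1
  obtain ⟨r1, -, r3⟩ := reduced_append.1 hr'
  refine ⟨by simp, ⟨x, h1⟩, reduced_append.2 ⟨r1, r1, ?_⟩⟩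
  simpa using r3

/-- A reduced closed walk is a conjugate of a closed immersed edge-path. -/
lemma exists_conjugate {u : List (E × Bool)} {v : V} (hne : u ≠ []) (hw : G.IsWalk v u v)
    (hr : Reduced u) : ∃ α δ, u = α ++ (δ ++ revWalk α) ∧ G.ClosedReduced δ := by
  induction hn : u.length using Nat.strong_induction_on generalizing v u with
  | _ n ih =>
    by_cases hrr : Reduced (u ++ u)
    · exact ⟨[], u, by simp, hne, ⟨v, hw⟩, hrr⟩
    · obtain ⟨a, t, rfl⟩ := List.exists_cons_of_ne_nil hne
      rw [reduced_append] at hrr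
      push Not at hrr
      obtain ⟨y, hy, z, hz, hzy⟩ := hrr hr hr
      simp only [List.head?_cons, Option.mem_def, Option.some.injEq] at hz
      subst hz
      rcases List.eq_nil_or_concat t with rfl | ⟨m, y', rfl⟩
      · simp only [List.getLast?_singleton, Option.mem_def, Option.some.injEq] at hy
        rw [hy] at hzy
        exact absurd hzy.symm (opp_ne _)
      · rw [List.concat_eq_append] at *
        rw [← List.cons_append] at hy
        simp only [List.getLast?_concat, Option.mem_def, Option.some.injEq] at hy
        -- Backtracking at the base point means that the last edge is the opposite of the first;
        -- this pair becomes the outermost layer of the conjugation.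
        obtain rfl : y' = opp a := by rw [hy, hzy, opp_opp]
        obtain ⟨hv, hw⟩ := hw
        obtain ⟨z, hm, hz, -⟩ := (G.isWalk_append).1 hw
        obtain ⟨r1, r2⟩ := reduced_cons.1 hr
        have hmne : m ≠ [] := by
          rintro rfl
          exact r1 (opp a) (by simp) rfl
        rw [dsrc_opp] at hz
        obtain ⟨α, δ, hm', hδ⟩ := ih m.length (by rw [← hn]; simp) hmne (hz ▸ hm)
          (reduced_append.1 r2).1 rfl
        exact ⟨a :: α, δ, by simp [hm'], hδ⟩

lemma isCommensurable_iff {a : ℝ} : IsCommensurable a Real.pi ↔ ∃ q : ℚ, a = q * Real.pi :=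
  exists_congr fun _ => div_eq_iff Real.pi_ne_zero

/-- An irrational ratio makes `a` and `b` independent over `ℚ`, so values can be prescribed on their
span and extended to `ℝ`. -/
lemma exists_linearMap_apply_eq {a b : ℝ} (hb : b ≠ 0) (h : ∀ q : ℚ, a ≠ q * b) (s t : ℝ) :
    ∃ φ : ℝ →ₗ[ℚ] ℝ, φ b = s ∧ φ a = t := by
  have hli : LinearIndependent ℚ ![b, a] := by
    rw [LinearIndependent.pair_iff' hb]
    intro q hq
    exact h q (by rw [← hq, Rat.smul_def])
  obtain ⟨φ, hφ⟩ := LinearMap.exists_extend ((Module.Basis.span hli).constr ℚ ![s, t])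
  have key : ∀ i, φ (![b, a] i) = ![s, t] i := fun i => by
    have h1 := LinearMap.congr_fun hφ (Module.Basis.span hli i)
    rw [Module.Basis.constr_basis] at h1
    rw [← h1, LinearMap.comp_apply, Submodule.subtype_apply, Module.Basis.span_apply]
  exact ⟨φ, by simpa using key 0, by simpa using key 1⟩

lemma map_eq_zero_of_isCommensurable {φ : ℝ →ₗ[ℚ] ℝ} (hπ : φ Real.pi = 0) {a : ℝ}
    (h : IsCommensurable a Real.pi) : φ a = 0 := by
  obtain ⟨q, rfl⟩ := isCommensurable_iff.1 h
  rw [← Rat.smul_def, map_smul, hπ, smul_zero]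

/-- Distinct vertices and cyclic reducedness make every underlying edge occur once, so only the
diagonal terms survive. -/
lemma overlap_self {l : List (E × Bool)} (hl : G.ClosedReduced l)
    (hnd : (l.map G.dsrc).Nodup) : G.overlap l l = G.wlen l := by
  classical
  obtain ⟨hne, ⟨v, hw⟩, hr⟩ := hl
  have : NeZero l.length := ⟨by simpa using hne⟩
  have hinj : ∀ i j : Fin l.length, G.dsrc l[i] = G.dsrc l[j] → i = j := by
    intro i j hij
    have hi : i.1 < (l.map G.dsrc).length := by simp
    have hj : j.1 < (l.map G.dsrc).length := by simp
    exact Fin.ext ((hnd.getElem_inj_iff (hi := hi) (hj := hj)).1 (by simpa using hij))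
  have hiff : ∀ i j : Fin l.length, l[i].1 = l[j].1 ↔ i = j := by
    refine fun i j => ⟨fun hij => ?_, fun h => by rw [h]⟩
    rcases eq_or_eq_opp (d := l[i]) (d' := l[j]) hij with h | h
    · exact hinj i j (by rw [h])
    · have h1 : i = j + 1 := hinj _ _ (by rw [h, dsrc_opp, hw.dtgt_cyclic G j])
      subst h1
      exact absurd h (hr.ne_cyclic j)
  rw [overlap_eq_sum, ← G.sum_getElem_len]
  simp only [hiff, Finset.sum_ite_eq, Finset.mem_univ, if_true]

/-- Dehn's argument: a cycle whose torus is tiled by squares has length commensurable with `π`. -/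
lemma DiamLEPi.isCommensurable_of_nodup (hS : G.DiamLEPi S)
    (hg : ENNReal.ofReal (2 * Real.pi) ≤ G.girth) {l : List (E × Bool)} (hl : G.ClosedReduced l)
    (hlS : ∀ d ∈ l, d.1 ∈ S) (hnd : (l.map G.dsrc).Nodup) :
    IsCommensurable (G.wlen l) Real.pi := by
  by_contra hcon
  rw [isCommensurable_iff] at hcon
  push Not at hcon
  obtain ⟨φ, h1, h2⟩ := exists_linearMap_apply_eq Real.pi_ne_zero hcon 1 1
  obtain ⟨c, x, hc, h⟩ := hS.torus_list hg hl hl hlS hlS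
  have h3 := h φ.toAddMonoidHom φ.toAddMonoidHom
  simp only [LinearMap.toAddMonoidHom_coe, overlap_self hl hnd, h1, h2] at h3
  have h4 : 0 ≤ ∑ i, ∑ j, c i j * (φ (x i j) * φ (x i j)) :=
    Finset.sum_nonneg fun i _ => Finset.sum_nonneg fun j _ =>
      mul_nonneg (hc i j) (mul_self_nonneg _)
  linarith

/-- Take `φ` with value `0` at `π` and `1` at the total length, and apply `DiamLEPi.len_mul` to `δ`
against the whole walk, `δ` against itself, and `δ` against `ε`. The overlap of `δ` with the whole
walk is the sum of the last two overlaps, on which `φ` vanishes, forcing `wlen δ = 0`. -/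
lemma DiamLEPi.isCommensurable_of_conjugates (hS : G.DiamLEPi S)
    (hg : ENNReal.ofReal (2 * Real.pi) ≤ G.girth) {α β δ ε : List (E × Bool)}
    (hl : G.ClosedReduced ((α ++ (δ ++ revWalk α)) ++ (β ++ (ε ++ revWalk β))))
    (hlS : ∀ d ∈ (α ++ (δ ++ revWalk α)) ++ (β ++ (ε ++ revWalk β)), d.1 ∈ S)
    (hnd : ((α ++ (δ ++ revWalk α)) ++ (β ++ (ε ++ revWalk β))).Nodup)
    (hδ : G.ClosedReduced δ) (hε : G.ClosedReduced ε)
    (hδ' : IsCommensurable (G.wlen δ) Real.pi) (hε' : IsCommensurable (G.wlen ε) Real.pi) :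
    IsCommensurable (G.wlen ((α ++ (δ ++ revWalk α)) ++ (β ++ (ε ++ revWalk β)))) Real.pi := by
  by_contra hcon
  rw [isCommensurable_iff] at hcon
  push Not at hcon
  obtain ⟨φ, h1, h2⟩ := exists_linearMap_apply_eq Real.pi_ne_zero hcon 0 1
  have hδ0 := map_eq_zero_of_isCommensurable h1 hδ'
  have hε0 := map_eq_zero_of_isCommensurable h1 hε'
  have hSδ : ∀ d ∈ δ, d.1 ∈ S := fun d hd => hlS d (by simp [hd])
  have hSε : ∀ d ∈ ε, d.1 ∈ S := fun d hd => hlS d (by simp [hd])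
  -- The tails occur in both directions, so absence of repeated directed edges separates `δ` from
  -- them even as undirected edges. In contrast, `δ` and `ε` may share edges run in opposite
  -- directions.
  have hdisj : ∀ a ∈ δ, (a ∉ α ∧ a ∉ revWalk α) ∧ a ∉ β ∧ a ∉ revWalk β := by
    simp only [List.nodup_append, List.mem_append] at hnd
    grind
  have hfst : ∀ ζ : List (E × Bool), (∀ a ∈ δ, a ∉ ζ ∧ a ∉ revWalk ζ) →
      ∀ a ∈ δ, ∀ b ∈ ζ, a.1 ≠ b.1 := by
    intro ζ hζ a ha b hb hab
    rcases eq_or_eq_opp hab with rfl | rfl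
    · exact (hζ _ ha).1 hb
    · exact (hζ _ ha).2 (mem_revWalk.2 (by rwa [opp_opp]))
  have hfst' : ∀ ζ : List (E × Bool), (∀ a ∈ δ, a ∉ ζ ∧ a ∉ revWalk ζ) →
      ∀ a ∈ δ, ∀ b ∈ revWalk ζ, a.1 ≠ b.1 := fun ζ hζ a ha b hb =>
    hfst ζ hζ a ha (opp b) (mem_revWalk.1 hb)
  have hα := fun a ha => (hdisj a ha).1
  have hβ := fun a ha => (hdisj a ha).2
  have key := fun l' (hl' : G.ClosedReduced l') hlS' =>
    hS.len_mul hg hδ hl' hSδ hlS' (φ := φ.toAddMonoidHom) h1 hδ0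
  have k1 := key _ hl hlS
  have k2 := key _ hδ hSδ
  have k3 := key _ hε hSε
  simp only [LinearMap.toAddMonoidHom_coe] at k1 k2 k3
  rw [h2] at k1
  simp only [overlap_append_right, G.overlap_eq_zero (hfst α hα), G.overlap_eq_zero (hfst' α hα),
    G.overlap_eq_zero (hfst β hβ), G.overlap_eq_zero (hfst' β hβ), zero_add, add_zero,
    map_add] at k1
  rw [hδ0] at k2
  rw [hε0] at k3
  have := G.wlen_pos hδ.1
  linarith

lemma IsCommensurable.add {a b : ℝ} (ha : IsCommensurable a Real.pi)
    (hb : IsCommensurable b Real.pi) : IsCommensurable (a + b) Real.pi := by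
  obtain ⟨p, hp⟩ := ha
  obtain ⟨q, hq⟩ := hb
  exact ⟨p + q, by rw [add_div, hp, hq]; push_cast; rfl⟩

theorem DiamLEPi.isCommensurable (hS : G.DiamLEPi S)
    (hg : ENNReal.ofReal (2 * Real.pi) ≤ G.girth) {l : List (E × Bool)} (hl : G.ClosedReduced l)
    (hlS : ∀ d ∈ l, d.1 ∈ S) : IsCommensurable (G.wlen l) Real.pi := by
  induction hn : l.length using Nat.strong_induction_on generalizing l with
  | _ n ih =>
    by_cases hnd : l.Nodup
    · by_cases hnd' : (l.map G.dsrc).Nodup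
      · exact hS.isCommensurable_of_nodup hg hl hlS hnd'
      · obtain ⟨l₁, a, l₂, b, l₃, rfl, hab⟩ := exists_split_of_not_nodup _ hnd'
        have hl' : G.ClosedReduced ((a :: l₂) ++ (b :: l₃ ++ l₁)) := by
          have := hl.rotate
          simpa using this
        have hnd2 : ((a :: l₂) ++ (b :: l₃ ++ l₁)).Nodup := by
          have := List.nodup_append_comm.1 hnd
          simpa using this
        obtain ⟨-, ⟨x, hw⟩, -⟩ := id hl'
        obtain ⟨y, hw1, hw2⟩ := (G.isWalk_append).1 hw
        obtain rfl : x = y := by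
          have h1 : G.dsrc a = x := hw1.1
          have h2 : G.dsrc b = y := hw2.1
          rw [← h1, ← h2, hab]
        have hred := reduced_append.1 hl'.reduced
        obtain ⟨α, δ, hu, hδ⟩ := exists_conjugate (by simp) hw1 hred.1
        obtain ⟨β, ε, hv, hε⟩ := exists_conjugate (by simp) hw2 hred.2.1
        have hlen : G.wlen (l₁ ++ a :: (l₂ ++ b :: l₃)) =
            G.wlen ((a :: l₂) ++ (b :: l₃ ++ l₁)) := by
          simp only [wlen_append, wlen_cons]; ring
        have hlS' : ∀ d ∈ (a :: l₂) ++ (b :: l₃ ++ l₁), d.1 ∈ S := fun d hd => hlS d (by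
          simp only [List.mem_append, List.mem_cons] at hd ⊢; tauto)
        have hn1 := congrArg List.length hu
        have hn2 := congrArg List.length hv
        simp only [List.length_append, List.length_cons] at hn hn1 hn2
        rw [hlen]
        rw [hu, hv] at hl' hnd2 hlS' ⊢
        exact hS.isCommensurable_of_conjugates hg hl' hlS' hnd2 hδ hε
          (ih δ.length (by omega) hδ (fun d hd => hlS' d (by simp [hd])) rfl)
          (ih ε.length (by omega) hε (fun d hd => hlS' d (by simp [hd])) rfl)
    · obtain ⟨l₁, a, l₂, b, l₃, rfl, hab⟩ := exists_split_of_not_nodup id (by simpa using hnd)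
      obtain rfl : a = b := hab
      have hl' : G.ClosedReduced ((a :: l₂) ++ (a :: (l₃ ++ l₁))) := by
        have := hl.rotate
        simpa using this
      have h1 := hl'.of_append_cons
      -- Both pieces start with the repeated edge `a`, and each is followed by `a` in the original
      -- walk, so closing them up creates no backtracking.
      have h2 := hl'.rotate.of_append_cons
      have hlen : G.wlen (l₁ ++ a :: (l₂ ++ a :: l₃)) =
          G.wlen (a :: l₂) + G.wlen (a :: (l₃ ++ l₁)) := by
        simp only [wlen_append, wlen_cons]; ring
      simp only [List.length_append, List.length_cons] at hn
      rw [hlen]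
      refine IsCommensurable.add (ih _ ?_ h1 (fun d hd => hlS d ?_) rfl)
        (ih _ ?_ h2 (fun d hd => hlS d ?_) rfl)
      · simp only [List.length_cons]; omega
      · simp only [List.mem_append, List.mem_cons] at hd ⊢; tauto
      · simp only [List.length_append, List.length_cons]; omega
      · simp only [List.mem_append, List.mem_cons] at hd ⊢; tauto

lemma isWalk_of_getElem {l : List (E × Bool)} (hne : l ≠ [])
    (h : ∀ (i : ℕ) (hi : i + 1 < l.length), G.dtgt l[i] = G.dsrc l[i + 1]) :
    G.IsWalk (G.dsrc (l.head hne)) l (G.dtgt (l.getLast hne)) := by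
  induction l with
  | nil => exact absurd rfl hne
  | cons d l ih =>
    cases l with
    | nil => exact ⟨rfl, rfl⟩
    | cons d' l =>
      refine ⟨rfl, ?_⟩
      have h0 := h 0 (by simp)
      simp only [List.getElem_cons_zero, List.getElem_cons_succ] at h0
      rw [h0, List.getLast_cons (by simp)]
      exact ih (by simp) fun i hi => h (i + 1) (by simpa using hi)

lemma ClosedEdgePath.closedReduced_ofFn {γ : G.ClosedEdgePath} (hγ : γ.IsImmersed) :
    G.ClosedReduced (List.ofFn γ.d) := by
  have hpos : 0 < γ.n := Nat.pos_of_ne_zero (NeZero.ne _)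
  have hsucc : ∀ i (hi : i + 1 < γ.n), (⟨i, by omega⟩ : Fin γ.n) + 1 = ⟨i + 1, hi⟩ := by
    intro i hi
    ext
    rw [Fin.val_add, Fin.val_one', Nat.add_mod_mod, Nat.mod_eq_of_lt hi]
  have hlast : (⟨γ.n - 1, by omega⟩ : Fin γ.n) + 1 = ⟨0, hpos⟩ := by
    ext
    rw [Fin.val_add, Fin.val_one', Nat.add_mod_mod, Nat.sub_add_cancel hpos, Nat.mod_self]
  have hne : List.ofFn γ.d ≠ [] := by simpa using hpos.ne'
  have hgl : (List.ofFn γ.d).getLast hne = γ.d ⟨γ.n - 1, by omega⟩ := by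
    rw [List.getLast_eq_getElem]; simp
  have hhd : (List.ofFn γ.d).head hne = γ.d ⟨0, hpos⟩ := by
    rw [List.head_eq_getElem]; simp
  have hred : Reduced (List.ofFn γ.d) := by
    refine List.isChain_iff_getElem.2 fun i hi => ?_
    have hi' : i + 1 < γ.n := by simpa using hi
    have := hγ ⟨i, by omega⟩
    rw [hsucc i hi'] at this
    simpa [opp] using this
  refine ⟨hne, ⟨G.dsrc ((List.ofFn γ.d).head hne), ?_⟩, reduced_append.2 ⟨hred, hred, ?_⟩⟩
  · have hw : ∀ (i : ℕ) (hi : i + 1 < (List.ofFn γ.d).length),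
        G.dtgt (List.ofFn γ.d)[i] = G.dsrc (List.ofFn γ.d)[i + 1] := by
      intro i hi
      have hi' : i + 1 < γ.n := by simpa using hi
      have := γ.closed ⟨i, by omega⟩
      rw [hsucc i hi'] at this
      simpa using this
    have hc : G.dtgt ((List.ofFn γ.d).getLast hne) = G.dsrc ((List.ofFn γ.d).head hne) := by
      rw [hgl, hhd, γ.closed, hlast]
    have := isWalk_of_getElem hne hw
    rwa [hc] at this
  · intro x hx y hy
    rw [List.getLast?_eq_some_getLast hne, hgl] at hx
    rw [List.head?_eq_some_head hne, hhd] at hy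
    simp only [Option.mem_def, Option.some.injEq] at hx hy
    subst hx hy
    have := hγ ⟨γ.n - 1, by omega⟩
    rwa [hlast] at this

end MetricGraph

open MetricGraph in
theorem corollary1p7 {V E : Type*} (G : MetricGraph V E) (γ : G.ClosedEdgePath)
    (hγ : γ.IsImmersed)
    (hgirth : ENNReal.ofReal (2 * Real.pi) ≤ G.girth)
    (hdist : ∀ x ∈ γ.image, ∀ y ∈ γ.image, G.dist x y ≤ ENNReal.ofReal Real.pi) :
    IsCommensurable γ.length Real.pi := by
  have hmem : ∀ d : E × Bool, d.1 ∈ Set.range (fun i => (γ.d i).1) →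
      ∀ s ∈ Set.Icc 0 (G.len d.1), G.dpt d s ∈ γ.image := by
    rintro d ⟨i, hi⟩ s hs
    refine Set.mem_iUnion.2 ⟨i, ?_⟩
    have := G.dpt_mem d hs
    rwa [← hi] at this
  have hS : G.DiamLEPi (Set.range fun i => (γ.d i).1) := fun d hd s hs d' hd' t ht =>
    hdist _ (hmem d hd s hs) _ (hmem d' hd' t ht)
  have := hS.isCommensurable hgirth (ClosedEdgePath.closedReduced_ofFn hγ) (fun d hd => by
    obtain ⟨i, rfl⟩ := (List.mem_ofFn' _ _).1 hd
    exact ⟨i, rfl⟩)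
  rwa [wlen, List.map_ofFn, List.sum_ofFn] at this
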